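/- **Definitions.** A *positive cone* of an abelian group $G$ is a subset $G^+\subseteq G$ with $G^++G^+\subseteq G^+$, $G^++(-G^+)=G$ and $G^+\cap(-G^+)=\{0\}$; write $a\le b$ if $b-a\in G^+$. A *unital ordered group* is a triple $(G,G^+,u)$ where $G^+$ is a positive cone of $G$ and $u\in G^+$ is such that for every $g\in G$ there is an integer $n\ge 1$ with $g\le nu$. An *isomorphism* $(G,G^+,u)\to(H,H^+,v)$ is a group isomorphism $\phi$ with $\phi(G^+)\subseteq H^+$, $\phi^{-1}(H^+)\subseteq G^+$ and $\phi(u)=v$. A *Cantor set* is a non-empty compact metrizable totally disconnected space without isolated points. A *minimal Cantor system* is a pair $(X,T)$ where $X$ is a Cantor set and $T:X\to X$ is continuous, surjective and such that every forward orbit is dense. For such a pair let $K^0(X,T)=C(X,\mathbb{Z})/\{f-f\circ T: f\in C(X,\mathbb{Z})\}$, let $K^0(X,T)^+$ be the set of classes of non-negative functions, and let $G(X,T)=(K^0(X,T),K^0(X,T)^+,[\mathbf 1_X])$. A map $Q:\{0,1,2,\dots\}\to\{0,1,2,\dots\}$ with $Q(0)=0$ is *increasing modulo intervals* if there is a strictly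 increasing sequence of integers $(q_n)_{n\ge 0}$ with $q_0=0$, $q_1=1$ and $Q(\{q_n,\dots,q_{n+1}-1\})\subseteq\{q_{n-1},\dots,q_n-1\}$ for every $n\ge 1$; then $Q(k)\le k-1$ for all $k\ge1$. For such $Q$ put $S_0=1$ and $S_k=S_{k-1}+S_{Q(k)}$ for $k\ge 1$, and let $$\Omega_Q=\{(x_k)_{k\ge 0}\in\{0,1\}^{\{0,1,2,\dots\}} : x_k=1 \text{ implies } x_j=0 \text{ for all integers } j \text{ with } Q(k+1)\le j\le k-1\},$$ with the topology induced by the product topology. For each integer $n\ge0$ there is a unique $\langle n\rangle=(x_k)_{k\ge 0}\in\Omega_Q$ with finitely many $1$'s and $\sum_{k}x_kS_k=n$. Let $T_Q:\Omega_Q\to\Omega_Q$ be the continuous extension of $\langle n\rangle\mapsto\langle n+1\rangle$. **Theorem.** Let $\Gamma$ be a countable additive subgroup of $\mathbb{R}$ that contains $1$ and is not contained in $\mathbb{Q}$. Then there is a map $Q:\{0,1,2,\dots\}\to\{0,1,2,\dots\}$ that is increasing modulo intervals, with $Q(0)=Q(1)=0$ and $Q(k)\le k-2$ for every integer $k\ge2$,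 such that $\Omega_Q$ is a Cantor set, the continuous extension $T_Q$ exists, $(\Omega_Q,T_Q)$ is a minimal Cantor system, $G(\Omega_Q,T_Q)$ is a unital ordered group, and $G(\Omega_Q,T_Q)$ is isomorphic as a unital ordered group to $(\Gamma,\Gamma\cap[0,\infty),1)$. -/

import Mathlib

open Filter Topology

noncomputable section

/-! ## Unital ordered groups -/

/-- A positive cone of an abelian group: `P + P ⊆ P`, `P + (-P) = G`, `P ∩ (-P) = {0}`. -/
structure IsPositiveCone {G : Type*} [AddCommGroup G] (P : Set G) : Prop where
  add_mem : ∀ a ∈ P, ∀ b ∈ P, a + b ∈ P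
  generates : ∀ g : G, ∃ a ∈ P, ∃ b ∈ P, g = a - b
  zero_mem : (0 : G) ∈ P
  eq_zero : ∀ a : G, a ∈ P → -a ∈ P → a = 0

/-- `(G, P, u)` is a unital ordered group: `P` is a positive cone of `G` and `u ∈ P` is an order
unit for the order `a ≤ b ↔ b - a ∈ P`. -/
structure IsUnitalOrderedGroup (G : Type*) [AddCommGroup G] (P : Set G) (u : G) : Prop where
  cone : IsPositiveCone P
  unit_mem : u ∈ P
  unit_spec : ∀ g : G, ∃ n : ℕ, 0 < n ∧ n • u - g ∈ P

/-- The triples `(G, P, u)` and `(H, R, v)` are isomorphic: there is a group isomorphism which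
is positive in both directions and maps `u` to `v`. -/
def UnitalOrderedGroupIsomorphic (G : Type*) [AddCommGroup G] (P : Set G) (u : G)
    (H : Type*) [AddCommGroup H] (R : Set H) (v : H) : Prop :=
  ∃ φ : G ≃+ H, (∀ a ∈ P, φ a ∈ R) ∧ (∀ b ∈ R, φ.symm b ∈ P) ∧ φ u = v

/-! ## Minimal Cantor systems and their ordered groups -/

/-- A Cantor set: a non-empty, compact, metrizable, totally disconnected space without isolated
points. -/
structure IsCantorSet (X : Type*) [TopologicalSpace X] : Prop where
  nonempty : Nonempty X
  compact : CompactSpace X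
  metrizable : TopologicalSpace.MetrizableSpace X
  totallyDisconnected : TotallyDisconnectedSpace X
  perfect : PerfectSpace X

/-- `(X, T)` is a (not necessarily invertible) minimal Cantor system. -/
structure IsMinimalCantorSystem (X : Type*) [TopologicalSpace X] (T : X → X) : Prop where
  cantor : IsCantorSet X
  continuous : Continuous T
  surjective : Function.Surjective T
  minimal : ∀ x : X, Dense (Set.range fun n : ℕ => T^[n] x)

/-- The subgroup of coboundaries `f - f ∘ T`, `f ∈ C(X, ℤ)`, of `C(X, ℤ)`. -/
def coboundaries {X : Type*} [TopologicalSpace X] (T : X → X) : AddSubgroup C(X, ℤ) where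
  carrier := {g | ∃ f : C(X, ℤ), ∀ x, g x = f x - f (T x)}
  zero_mem' := ⟨0, fun x => by simp⟩
  add_mem' := by
    rintro a b ⟨f, hf⟩ ⟨g, hg⟩
    refine ⟨f + g, fun x => ?_⟩
    simp only [ContinuousMap.add_apply, hf x, hg x]
    ring
  neg_mem' := by
    rintro a ⟨f, hf⟩
    refine ⟨-f, fun x => ?_⟩
    simp only [ContinuousMap.neg_apply, hf x]
    ring

/-- The group `K⁰(X, T)`. -/
abbrev KZero {X : Type*} [TopologicalSpace X] (T : X → X) : Type _ :=
  C(X, ℤ) ⧸ coboundaries T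

/-- The set `K⁰(X, T)⁺` of the classes of non-negative functions. -/
def KZero.positive {X : Type*} [TopologicalSpace X] (T : X → X) : Set (KZero T) :=
  {a | ∃ f : C(X, ℤ), (∀ x, 0 ≤ f x) ∧ (QuotientAddGroup.mk f : KZero T) = a}

/-- The class of the constant function `1`. -/
def KZero.unit {X : Type*} [TopologicalSpace X] (T : X → X) : KZero T :=
  QuotientAddGroup.mk (1 : C(X, ℤ))

/-! ## Generalized odometers -/

/-- `Q` is increasing modulo intervals: `Q 0 = 0` and, for some strictly increasing sequence
`0 = q 0 < 1 = q 1 < q 2 < ⋯`, the map `Q` sends `[q n, q (n + 1) - 1]` into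
`[q (n - 1), q n - 1]` for every `n ≥ 1`. -/
def IncreasingModuloIntervals (Q : ℕ → ℕ) : Prop :=
  Q 0 = 0 ∧ ∃ q : ℕ → ℕ, StrictMono q ∧ q 0 = 0 ∧ q 1 = 1 ∧
    ∀ n k : ℕ, q (n + 1) ≤ k → k < q (n + 2) → q n ≤ Q k ∧ Q k < q (n + 1)

theorem IncreasingModuloIntervals.le_pred {Q : ℕ → ℕ} (h : IncreasingModuloIntervals Q) :
    ∀ k, 1 ≤ k → Q k ≤ k - 1 := by
  obtain ⟨-, q, hq, -, h1, hQ⟩ := h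
  intro k hk
  have hex : ∃ n, k < q (n + 2) := ⟨k, lt_of_lt_of_le (by omega : k < k + 2) (hq.id_le (k + 2))⟩
  classical
  have hlt := Nat.find_spec hex
  have hle : q (Nat.find hex + 1) ≤ k := by
    rcases Nat.eq_zero_or_pos (Nat.find hex) with h0 | h0
    · rw [h0]
      simpa [h1] using hk
    · have := Nat.find_min hex (Nat.sub_lt h0 one_pos)
      have e : Nat.find hex - 1 + 2 = Nat.find hex + 1 := by omega
      rw [e] at this
      omega
  have := (hQ _ k hle hlt).2
  omega

/-- The sequence `S 0 = 1`, `S k = S (k - 1) + S (Q k)`. (The minimum makes the recursion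
well-founded for every `Q`; it is inactive when `Q k ≤ k - 1` for `k ≥ 1`.) -/
def odometerScale (Q : ℕ → ℕ) : ℕ → ℕ
  | 0 => 1
  | k + 1 => odometerScale Q k + odometerScale Q (min (Q (k + 1)) k)
termination_by k => k
decreasing_by all_goals omega

theorem odometerScale_zero (Q : ℕ → ℕ) : odometerScale Q 0 = 1 := by
  rw [odometerScale]

theorem odometerScale_succ {Q : ℕ → ℕ} (hQ : ∀ k, 1 ≤ k → Q k ≤ k - 1) (k : ℕ) :
    odometerScale Q (k + 1) = odometerScale Q k + odometerScale Q (Q (k + 1)) := by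
  have h : min (Q (k + 1)) k = Q (k + 1) := min_eq_left (by simpa using hQ (k + 1) (by omega))
  rw [odometerScale, h]

/-- The set `Ω_Q` of `0`-`1` sequences `x` such that `x k = 1` implies `x j = 0` for all
`j ∈ [Q (k + 1), k - 1]`. -/
def odometerSet (Q : ℕ → ℕ) : Set (ℕ → Bool) :=
  {x | ∀ k, x k = true → ∀ j, Q (k + 1) ≤ j → j < k → x j = false}

/-- `Ω_Q` with the topology induced by the product topology of `{0, 1}^ℕ`. -/
abbrev OdometerSpace (Q : ℕ → ℕ) : Type := odometerSet Q

instance OdometerSpace.instNonempty (Q : ℕ → ℕ) : Nonempty (OdometerSpace Q) :=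
  ⟨⟨fun _ => false, fun k hk => by simp at hk⟩⟩

/-- `x` has only finitely many `1`'s, and `∑ k, x k * S k = n`. -/
def IsExpansion (Q : ℕ → ℕ) (x : ℕ → Bool) (n : ℕ) : Prop :=
  ∃ m : ℕ, (∀ k, m ≤ k → x k = false) ∧
    ∑ k ∈ Finset.range m, (x k).toNat * odometerScale Q k = n

theorem odometerScale_pos {Q : ℕ → ℕ} (hQ : ∀ k, 1 ≤ k → Q k ≤ k - 1) (k : ℕ) :
    0 < odometerScale Q k := by
  induction k with
  | zero => simp [odometerScale_zero]
  | succ k ih => rw [odometerScale_succ hQ]; omega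

theorem lt_odometerScale {Q : ℕ → ℕ} (hQ : ∀ k, 1 ≤ k → Q k ≤ k - 1) (k : ℕ) :
    k < odometerScale Q k := by
  induction k with
  | zero => simp [odometerScale_zero]
  | succ k ih =>
    rw [odometerScale_succ hQ]
    have := odometerScale_pos hQ (Q (k + 1))
    omega

theorem sum_lt_odometerScale {Q : ℕ → ℕ} (hQ : ∀ k, 1 ≤ k → Q k ≤ k - 1) {x : ℕ → Bool}
    (hx : x ∈ odometerSet Q) (m : ℕ) :
    ∑ k ∈ Finset.range m, (x k).toNat * odometerScale Q k < odometerScale Q m := by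
  induction m using Nat.strong_induction_on with
  | _ m ih =>
    rcases m with _ | m
    · simp [odometerScale_zero]
    · rw [Finset.sum_range_succ, odometerScale_succ hQ]
      cases hm : x m with
      | false =>
        have := ih m (by omega)
        simp
        omega
      | true =>
        have hle : Q (m + 1) ≤ m := by simpa using hQ (m + 1) (by omega)
        have h1 := ih (Q (m + 1)) (by omega)
        have h2 : ∑ k ∈ Finset.range m, (x k).toNat * odometerScale Q k =
            ∑ k ∈ Finset.range (Q (m + 1)), (x k).toNat * odometerScale Q k := by
          symm
          apply Finset.sum_subset
          · intro k hk
            simp only [Finset.mem_range] at hk ⊢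
            omega
          · intro k hk hk'
            simp only [Finset.mem_range] at hk hk'
            simp [hx m hm k (by omega) hk]
        rw [h2]
        simp
        omega

theorem exists_sum_eq {Q : ℕ → ℕ} (hQ : ∀ k, 1 ≤ k → Q k ≤ k - 1) (m : ℕ) :
    ∀ n < odometerScale Q m, ∃ x ∈ odometerSet Q, (∀ k, m ≤ k → x k = false) ∧
      ∑ k ∈ Finset.range m, (x k).toNat * odometerScale Q k = n := by
  induction m using Nat.strong_induction_on with
  | _ m ih =>
    intro n hn
    rcases m with _ | m
    · rw [odometerScale_zero] at hn
      exact ⟨fun _ => false, fun k hk => by simp at hk, fun _ _ => rfl, by simp; omega⟩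
    · rw [odometerScale_succ hQ] at hn
      have hle : Q (m + 1) ≤ m := by simpa using hQ (m + 1) (by omega)
      by_cases h : n < odometerScale Q m
      · obtain ⟨x, hx, h0, hs⟩ := ih m (by omega) n h
        refine ⟨x, hx, fun k hk => h0 k (by omega), ?_⟩
        rw [Finset.sum_range_succ, h0 m le_rfl, hs]
        simp
      · obtain ⟨x, hx, h0, hs⟩ :=
          ih (Q (m + 1)) (by omega) (n - odometerScale Q m) (by omega)
        refine ⟨Function.update x m true, ?_, ?_, ?_⟩
        · intro k hk j hj hjk
          by_cases hkm : k = m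
          · subst hkm
            rw [Function.update_of_ne (by omega)]
            exact h0 j hj
          · rw [Function.update_of_ne hkm] at hk
            have hk' : k < m := by
              by_contra hc
              rw [h0 k (by omega)] at hk
              simp at hk
            rw [Function.update_of_ne (by omega)]
            exact hx k hk j hj hjk
        · intro k hk
          rw [Function.update_of_ne (by omega)]
          exact h0 k (by omega)
        · have h2 : ∑ k ∈ Finset.range m,
              (Function.update x m true k).toNat * odometerScale Q k =
              ∑ k ∈ Finset.range (Q (m + 1)), (x k).toNat * odometerScale Q k := by
            have h3 : ∑ k ∈ Finset.range m,
                (Function.update x m true k).toNat * odometerScale Q k =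
                ∑ k ∈ Finset.range m, (x k).toNat * odometerScale Q k := by
              apply Finset.sum_congr rfl
              intro k hk
              rw [Finset.mem_range] at hk
              rw [Function.update_of_ne (by omega)]
            rw [h3]
            symm
            apply Finset.sum_subset
            · intro k hk
              simp only [Finset.mem_range] at hk ⊢
              omega
            · intro k _ hk'
              simp only [Finset.mem_range] at hk'
              rw [h0 k (by omega)]
              simp
          rw [Finset.sum_range_succ, h2, hs]
          simp
          omega

theorem eq_of_sum_eq {Q : ℕ → ℕ} (hQ : ∀ k, 1 ≤ k → Q k ≤ k - 1) {x y : ℕ → Bool}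
    (hx : x ∈ odometerSet Q) (hy : y ∈ odometerSet Q) (m : ℕ)
    (h : ∑ k ∈ Finset.range m, (x k).toNat * odometerScale Q k =
      ∑ k ∈ Finset.range m, (y k).toNat * odometerScale Q k) :
    ∀ k < m, x k = y k := by
  induction m with
  | zero => intro k hk; omega
  | succ m ih =>
    have hxm := sum_lt_odometerScale hQ hx m
    have hym := sum_lt_odometerScale hQ hy m
    rw [Finset.sum_range_succ, Finset.sum_range_succ] at h
    have e : x m = y m := by
      cases h1 : x m <;> cases h2 : y m <;> simp [h1, h2] at h ⊢ <;> omega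
    rw [e] at h
    intro k hk
    rcases Nat.lt_succ_iff_lt_or_eq.mp hk with hk | rfl
    · exact ih (by omega) k hk
    · exact e

/-- Every `n` has exactly one expansion in `Ω_Q`. -/
theorem existsUnique_isExpansion {Q : ℕ → ℕ} (hQ : ∀ k, 1 ≤ k → Q k ≤ k - 1) (n : ℕ) :
    ∃! x : OdometerSpace Q, IsExpansion Q x n := by
  obtain ⟨x, hx, h0, hs⟩ := exists_sum_eq hQ n n (lt_odometerScale hQ n)
  refine ⟨⟨x, hx⟩, ⟨n, h0, hs⟩, ?_⟩
  have ext_sum : ∀ (z : ℕ → Bool) (a b : ℕ), (∀ k, a ≤ k → z k = false) → a ≤ b →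
      ∑ k ∈ Finset.range b, (z k).toNat * odometerScale Q k =
        ∑ k ∈ Finset.range a, (z k).toNat * odometerScale Q k := by
    intro z a b hz hab
    symm
    apply Finset.sum_subset
    · intro k hk
      simp only [Finset.mem_range] at hk ⊢
      omega
    · intro k _ hk'
      simp only [Finset.mem_range] at hk'
      simp [hz k (by omega)]
  rintro ⟨y, hy⟩ ⟨m, h0', hs'⟩
  simp only at h0' hs'
  apply Subtype.ext
  funext k
  refine eq_of_sum_eq hQ hy hx (max (max m n) (k + 1)) ?_ k (by omega)
  rw [ext_sum y m _ h0' (by omega), ext_sum x n _ h0 (by omega), hs, hs']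

/-- The expansion `⟨n⟩ ∈ Ω_Q` of `n`: the unique `x ∈ Ω_Q` with finitely many `1`'s such that
`∑ k, x k * S k = n`. -/
def expansion (Q : ℕ → ℕ) (n : ℕ) : OdometerSpace Q :=
  Classical.epsilon fun x : OdometerSpace Q => IsExpansion Q x n

theorem isExpansion_expansion {Q : ℕ → ℕ} (hQ : ∀ k, 1 ≤ k → Q k ≤ k - 1) (n : ℕ) :
    IsExpansion Q (expansion Q n) n :=
  Classical.epsilon_spec (existsUnique_isExpansion hQ n).exists

/-- The map `T_Q : Ω_Q → Ω_Q`, the extension by continuity of `⟨n⟩ ↦ ⟨n + 1⟩`: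
`T_Q x` is the limit of `⟨n + 1⟩` as `⟨n⟩` tends to `x`. -/
def odometerMap (Q : ℕ → ℕ) (x : OdometerSpace Q) : OdometerSpace Q :=
  limUnder (comap (expansion Q) (𝓝 x)) fun n => expansion Q (n + 1)

end

/-! A continuous integer function on `Ω_Q` depends on finitely many digits, so its sums `g k` over
the first `S k` points of the orbit of `⟨0⟩` satisfy `g (k + 1) = g k + g (Q (k + 1))` for large
`k`. The sums vanish eventually exactly for coboundaries (`orbitSum_coboundary`,
`mem_coboundaries_of_orbitSum_eq_zero`), and every non-negative, eventually recursive sequence comes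
from a non-negative function (`exists_orbitSum_eq`). So `K⁰` and its order can be read off from
germs at infinity of recursive sequences.

Positive weights `A` with `A k = A (k + 1) + ∑ A i`, summed over `i ≥ 1` with `Q i = k`, define a
functional on such germs: `A k * g k + ∑ A i * g (Q i)`, summed over `i > k` with `Q i < k`, does
not change with `k` (`windowValue_succ`). It sends the germ of `S`, that is the unit, to `A 0 = 1`.
If the weights lie in `Γ`, the functional is injective and each positive `γ ∈ Γ` is the value of a
non-negative sequence, then it identifies `K⁰` with `Γ` as a unital ordered group
(`exists_addEquiv_KZero`).

It remains to find `Q` and `A`, which are built together, block by block. At a stage each index `j`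
of the last block has a defect, the part of `A j` not yet accounted for. The next block writes every
defect as a sum of new weights, in non-increasing order, each new index `i` being labelled by the `j
= Q i` that it serves (`Stage.Valid.exists_extends_of_multiset`). The new defects are then
essentially differences of consecutive weights.

Two kinds of blocks alternate. One (`Stage.IsOpen.exists_extends`) arranges that the new defects,
and a prescribed `γ` if it is positive, are non-negative integral combinations of a linearly
independent family `f` in `Γ`, and that the last weight is the sum of the largest and smallest
members of `f`. The other (`Stage.IsAdapted.exists_extends`) uses the members of `f` themselves as
weights. Linear independence turns the vanishing of the functional into one integral equation for
each member of `f`; partial sums of these equations are the values of the sequence where the weight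
drops, which are the only values that later indices use. This gives injectivity. Telescoping the
defects writes every member of `f`, hence `γ`, as a value on a non-negative sequence.

The arithmetic input is `exists_refines_mem`: in a group generated by at least two independent
positive reals, any positive element becomes a non-negative combination after a change of generators
under which the old ones stay non-negative combinations. Rank two is the subtractive Euclidean
algorithm; higher rank follows by induction and density. -/

/-! ## Expansions -/

/-- The number whose expansion is the truncation of `x` to its first `m` digits. -/
def truncation (Q : ℕ → ℕ) (x : ℕ → Bool) (m : ℕ) : ℕ :=
  ∑ k ∈ Finset.range m, (x k).toNat * odometerScale Q k

theorem truncation_congr {Q : ℕ → ℕ} {x y : ℕ → Bool} {m : ℕ} (h : ∀ k < m, x k = y k) :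
    truncation Q x m = truncation Q y m :=
  Finset.sum_congr rfl fun k hk => by rw [h k (Finset.mem_range.mp hk)]

theorem odometerScale_strictMono {Q : ℕ → ℕ} (hQ : ∀ k, 1 ≤ k → Q k ≤ k - 1) :
    StrictMono (odometerScale Q) := by
  refine strictMono_nat_of_lt_succ fun k => ?_
  rw [odometerScale_succ hQ]
  have := odometerScale_pos hQ (Q (k + 1))
  omega

theorem expansion_eq {Q : ℕ → ℕ} (hQ : ∀ k, 1 ≤ k → Q k ≤ k - 1) {n : ℕ} {x : OdometerSpace Q}
    (h : IsExpansion Q x n) : expansion Q n = x :=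
  (existsUnique_isExpansion hQ n).unique (isExpansion_expansion hQ n) h

theorem expansion_apply_of_lt {Q : ℕ → ℕ} (hQ : ∀ k, 1 ≤ k → Q k ≤ k - 1) {n m : ℕ}
    (hn : n < odometerScale Q m) {k : ℕ} (hk : m ≤ k) :
    (expansion Q n : ℕ → Bool) k = false := by
  obtain ⟨x, hx, h0, hs⟩ := exists_sum_eq hQ m n hn
  rw [expansion_eq hQ (x := ⟨x, hx⟩) ⟨m, h0, hs⟩]
  exact h0 k hk

theorem truncation_expansion {Q : ℕ → ℕ} (hQ : ∀ k, 1 ≤ k → Q k ≤ k - 1) {n m : ℕ}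
    (hn : n < odometerScale Q m) : truncation Q (expansion Q n) m = n := by
  obtain ⟨x, hx, h0, hs⟩ := exists_sum_eq hQ m n hn
  rw [expansion_eq hQ (x := ⟨x, hx⟩) ⟨m, h0, hs⟩]
  exact hs

theorem truncation_lt {Q : ℕ → ℕ} (hQ : ∀ k, 1 ≤ k → Q k ≤ k - 1) (x : OdometerSpace Q) (m : ℕ) :
    truncation Q x m < odometerScale Q m :=
  sum_lt_odometerScale hQ x.2 m

theorem expansion_truncation_apply {Q : ℕ → ℕ} (hQ : ∀ k, 1 ≤ k → Q k ≤ k - 1)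
    (x : OdometerSpace Q) {m k : ℕ} (hk : k < m) :
    (expansion Q (truncation Q x m) : ℕ → Bool) k = (x : ℕ → Bool) k :=
  eq_of_sum_eq hQ (expansion Q _).2 x.2 m (truncation_expansion hQ (truncation_lt hQ x m)) k hk

theorem expansion_zero {Q : ℕ → ℕ} (hQ : ∀ k, 1 ≤ k → Q k ≤ k - 1) (k : ℕ) :
    (expansion Q 0 : ℕ → Bool) k = false :=
  expansion_apply_of_lt hQ (m := 0) (by simp [odometerScale_zero]) (Nat.zero_le k)

/-- An `i` below `S (Q (K + 1))` has no digit `1` from the place `Q (K + 1)` on, so the constraint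
imposed by a `1` at the place `K` is met. -/
theorem isExpansion_update {Q : ℕ → ℕ} (hQ : ∀ k, 1 ≤ k → Q k ≤ k - 1) {K i : ℕ}
    (hi : i < odometerScale Q (Q (K + 1))) :
    ∃ x : OdometerSpace Q, (x : ℕ → Bool) = Function.update (expansion Q i : ℕ → Bool) K true ∧
      IsExpansion Q x (odometerScale Q K + i) := by
  have hle : Q (K + 1) ≤ K := by simpa using hQ (K + 1) (by omega)
  have hiK : i < odometerScale Q K :=
    hi.trans_le ((odometerScale_strictMono hQ).monotone hle)
  have h0 : ∀ k, Q (K + 1) ≤ k → (expansion Q i : ℕ → Bool) k = false :=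
    fun k hk => expansion_apply_of_lt hQ hi hk
  refine ⟨⟨Function.update (expansion Q i : ℕ → Bool) K true, ?_⟩, rfl, K + 1, ?_, ?_⟩
  · intro k hk j hj hjk
    by_cases hkm : k = K
    · subst hkm
      rw [Function.update_of_ne (by omega)]
      exact h0 j hj
    · rw [Function.update_of_ne hkm] at hk
      have hk' : k < K := by
        by_contra hc
        rw [h0 k (by omega)] at hk
        simp at hk
      rw [Function.update_of_ne (by omega)]
      exact (expansion Q i).2 k hk j hj hjk
  · intro k hk
    simp only
    rw [Function.update_of_ne (by omega)]
    exact h0 k (by omega)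
  · have h3 : ∑ k ∈ Finset.range K,
        (Function.update (expansion Q i : ℕ → Bool) K true k).toNat * odometerScale Q k = i := by
      rw [← truncation_expansion hQ hiK]
      refine Finset.sum_congr rfl fun k hk => ?_
      rw [Finset.mem_range] at hk
      rw [Function.update_of_ne (by omega), truncation_expansion hQ hiK]
    simp only
    rw [Finset.sum_range_succ, h3]
    simp
    omega

theorem expansion_scale_add {Q : ℕ → ℕ} (hQ : ∀ k, 1 ≤ k → Q k ≤ k - 1) {K i : ℕ}
    (hi : i < odometerScale Q (Q (K + 1))) :
    (expansion Q (odometerScale Q K + i) : ℕ → Bool) =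
      Function.update (expansion Q i : ℕ → Bool) K true := by
  obtain ⟨x, hx, hxe⟩ := isExpansion_update hQ hi
  rw [expansion_eq hQ hxe, hx]

theorem expansion_scale_add_apply_of_ne {Q : ℕ → ℕ} (hQ : ∀ k, 1 ≤ k → Q k ≤ k - 1) {K i j : ℕ}
    (hi : i < odometerScale Q (Q (K + 1))) (hj : j ≠ K) :
    (expansion Q (odometerScale Q K + i) : ℕ → Bool) j = (expansion Q i : ℕ → Bool) j := by
  rw [expansion_scale_add hQ hi, Function.update_of_ne hj]

theorem expansion_scale {Q : ℕ → ℕ} (hQ : ∀ k, 1 ≤ k → Q k ≤ k - 1) {K j : ℕ} (hj : j ≠ K) :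
    (expansion Q (odometerScale Q K) : ℕ → Bool) j = false := by
  have := expansion_scale_add_apply_of_ne hQ (K := K) (i := 0) (odometerScale_pos hQ _) hj
  rw [add_zero] at this
  rw [this, expansion_zero hQ]

/-- The basis of the inductions on `n` below: removing the leading digit `K` leaves an `i` whose
expansion has the same digits at all other places. -/
theorem exists_leading_digit {Q : ℕ → ℕ} (hQ : ∀ k, 1 ≤ k → Q k ≤ k - 1) {n M : ℕ}
    (h : odometerScale Q M ≤ n) :
    ∃ K i, M ≤ K ∧ n = odometerScale Q K + i ∧ i < odometerScale Q (Q (K + 1)) := by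
  have hex : ∃ m, n < odometerScale Q m := ⟨n, lt_odometerScale hQ n⟩
  classical
  have h1 := Nat.find_spec hex
  have hM : M < Nat.find hex := by
    by_contra hc
    have := (odometerScale_strictMono hQ).monotone (not_lt.mp hc)
    omega
  obtain ⟨K, hK⟩ : ∃ K, Nat.find hex = K + 1 := ⟨Nat.find hex - 1, by omega⟩
  have h2 := Nat.find_min hex (m := K) (by omega)
  rw [hK, odometerScale_succ hQ] at h1
  exact ⟨K, n - odometerScale Q K, by omega, by omega, by omega⟩

/-! ## Topology of `Ω_Q` -/

theorem OdometerSpace.tendsto_of_digits {Q : ℕ → ℕ} {ι : Type*} {l : Filter ι}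
    {u : ι → OdometerSpace Q} {x : OdometerSpace Q}
    (h : ∀ k, ∀ᶠ i in l, (u i : ℕ → Bool) k = (x : ℕ → Bool) k) : Tendsto u l (𝓝 x) := by
  rw [tendsto_subtype_rng, tendsto_pi_nhds]
  intro k
  refine tendsto_const_nhds.congr' ?_
  filter_upwards [h k] with i hi using hi.symm

theorem OdometerSpace.eventually_digits {Q : ℕ → ℕ} (x : OdometerSpace Q) (M : ℕ) :
    ∀ᶠ y : OdometerSpace Q in 𝓝 x, ∀ k < M, (y : ℕ → Bool) k = (x : ℕ → Bool) k := by
  have h : ∀ k ∈ Finset.range M, ∀ᶠ y : OdometerSpace Q in 𝓝 x,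
      (y : ℕ → Bool) k = (x : ℕ → Bool) k := by
    intro k _
    have hc : Continuous fun y : OdometerSpace Q => (y : ℕ → Bool) k :=
      (continuous_apply k).comp continuous_subtype_val
    exact (hc.continuousAt (x := x)).eventually_mem (s := {(x : ℕ → Bool) k}) (by simp)
  have := (Finset.eventually_all (Finset.range M)).mpr h
  simpa using this

theorem OdometerSpace.continuous_of_digits {Q : ℕ → ℕ} {β : Type*} [TopologicalSpace β]
    {f : OdometerSpace Q → β} (M : ℕ)
    (h : ∀ x y : OdometerSpace Q, (∀ k < M, (x : ℕ → Bool) k = (y : ℕ → Bool) k) → f x = f y) :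
    Continuous f := by
  refine continuous_iff_continuousAt.mpr fun x => ?_
  refine tendsto_const_nhds.congr' ?_
  filter_upwards [eventually_digits x M] with y hy
  exact (h y x hy).symm

theorem isClosed_odometerSet (Q : ℕ → ℕ) : IsClosed (odometerSet Q) := by
  have : odometerSet Q = ⋂ k, ⋂ j, {x : ℕ → Bool | x k = true → Q (k + 1) ≤ j → j < k →
      x j = false} := by
    ext x
    rw [Set.mem_iInter]
    simp only [Set.mem_iInter]
    exact ⟨fun h k j hk hj hjk => h k hk j hj hjk, fun h k hk j hj hjk => h k j hk hj hjk⟩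
  rw [this]
  refine isClosed_iInter fun k => isClosed_iInter fun j => ?_
  have hc : Continuous fun x : ℕ → Bool => (x k, x j) :=
    (continuous_apply k).prodMk (continuous_apply j)
  exact (isClosed_discrete {p : Bool × Bool | p.1 = true → Q (k + 1) ≤ j → j < k →
    p.2 = false}).preimage hc

instance OdometerSpace.instCompactSpace (Q : ℕ → ℕ) : CompactSpace (OdometerSpace Q) :=
  isCompact_iff_compactSpace.mp (isClosed_odometerSet Q).isCompact

/-- Compactness: the pairs that agree on `M` digits but are separated by `f` form decreasing closed
sets, and a point common to all of them would be a pair `(x, x)` with `f x ≠ f x`. -/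
theorem OdometerSpace.exists_digits {Q : ℕ → ℕ} (f : C(OdometerSpace Q, ℤ)) :
    ∃ M, ∀ x y : OdometerSpace Q, (∀ k < M, (x : ℕ → Bool) k = (y : ℕ → Bool) k) → f x = f y := by
  by_contra! hcon
  let t : ℕ → Set (OdometerSpace Q × OdometerSpace Q) := fun M =>
    {p | (∀ k < M, (p.1 : ℕ → Bool) k = (p.2 : ℕ → Bool) k) ∧ f p.1 ≠ f p.2}
  have hclosed : ∀ M, IsClosed (t M) := by
    intro M
    have h1 : t M = (⋂ k, ⋂ _ : k < M, {p : OdometerSpace Q × OdometerSpace Q |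
        (p.1 : ℕ → Bool) k = (p.2 : ℕ → Bool) k}) ∩ {p | f p.1 ≠ f p.2} := by
      ext p
      simp [t]
    rw [h1]
    refine IsClosed.inter (isClosed_iInter fun k => isClosed_iInter fun _ => ?_) ?_
    · exact isClosed_eq
        ((continuous_apply k).comp (continuous_subtype_val.comp continuous_fst))
        ((continuous_apply k).comp (continuous_subtype_val.comp continuous_snd))
    · have hc : Continuous fun p : OdometerSpace Q × OdometerSpace Q => (f p.1, f p.2) := by
        fun_prop
      exact (isClosed_discrete {p : ℤ × ℤ | p.1 ≠ p.2}).preimage hc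
  obtain ⟨p, hp⟩ := IsCompact.nonempty_iInter_of_sequence_nonempty_isCompact_isClosed t
    (fun M p hp => ⟨fun k hk => hp.1 k (by omega), hp.2⟩)
    (fun M => by
      obtain ⟨x, y, hxy, hne⟩ := hcon M
      exact ⟨(x, y), hxy, hne⟩)
    (hclosed 0).isCompact hclosed
  rw [Set.mem_iInter] at hp
  refine (hp 0).2 (congrArg f (Subtype.ext (funext fun k => ?_)))
  exact (hp (k + 1)).1 k (by omega)

theorem tendsto_expansion_truncation {Q : ℕ → ℕ} (hQ : ∀ k, 1 ≤ k → Q k ≤ k - 1)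
    (x : OdometerSpace Q) :
    Tendsto (fun m => expansion Q (truncation Q x m)) atTop (𝓝 x) :=
  OdometerSpace.tendsto_of_digits fun k => by
    filter_upwards [eventually_gt_atTop k] with m hm
    exact expansion_truncation_apply hQ x hm

theorem denseRange_expansion {Q : ℕ → ℕ} (hQ : ∀ k, 1 ≤ k → Q k ≤ k - 1) :
    DenseRange (expansion Q) := fun x =>
  mem_closure_of_tendsto (tendsto_expansion_truncation hQ x)
    (Eventually.of_forall fun _ => Set.mem_range_self _)

theorem tendsto_expansion_scale {Q : ℕ → ℕ} (hQ : ∀ k, 1 ≤ k → Q k ≤ k - 1) :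
    Tendsto (fun k => expansion Q (odometerScale Q k)) atTop (𝓝 (expansion Q 0)) :=
  OdometerSpace.tendsto_of_digits fun k => by
    filter_upwards [eventually_gt_atTop k] with m hm
    rw [expansion_scale hQ (by omega), expansion_zero hQ]

/-! ## The odometer map -/

theorem exists_forall_le_of_tendsto {Q : ℕ → ℕ} (hlim : Tendsto Q atTop atTop) (M : ℕ) :
    ∃ M', M ≤ M' ∧ ∀ k, M' ≤ k → M ≤ Q (k + 1) := by
  obtain ⟨N, hN⟩ := eventually_atTop.mp (hlim.eventually_ge_atTop M)
  exact ⟨max M N, le_max_left _ _, fun k hk => hN _ (by omega)⟩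

/-- Uniform continuity of `⟨n⟩ ↦ ⟨n + 1⟩`: a leading digit at a place `K ≥ M'` does not influence
the first `M` digits of the successor, even when it takes part in a carry. -/
theorem expansion_succ_apply {Q : ℕ → ℕ} (hQ : ∀ k, 1 ≤ k → Q k ≤ k - 1) {M M' : ℕ}
    (hM : M ≤ M') (hM' : ∀ k, M' ≤ k → M ≤ Q (k + 1)) (n : ℕ) {j : ℕ} (hj : j < M) :
    (expansion Q (n + 1) : ℕ → Bool) j =
      (expansion Q (truncation Q (expansion Q n) M' + 1) : ℕ → Bool) j := by
  induction n using Nat.strong_induction_on with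
  | _ n ih =>
    rcases lt_or_ge n (odometerScale Q M') with hn | hn
    · rw [truncation_expansion hQ hn]
    · obtain ⟨K, i, hK, rfl, hi⟩ := exists_leading_digit hQ hn
      have hpos := odometerScale_pos hQ K
      have htr : truncation Q (expansion Q (odometerScale Q K + i)) M' =
          truncation Q (expansion Q i) M' :=
        truncation_congr fun k hk => expansion_scale_add_apply_of_ne hQ hi (by omega)
      rw [htr, ← ih i (by omega)]
      rcases lt_or_ge (i + 1) (odometerScale Q (Q (K + 1))) with h | h
      · rw [add_assoc, expansion_scale_add_apply_of_ne hQ h (by omega)]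
      -- The carry: both successors are scale numbers, `S (K + 1)` and `S (Q (K + 1))`, whose only
      -- digit `1` lies at a place `≥ M`.
      · have hi' : i + 1 = odometerScale Q (Q (K + 1)) := by omega
        have := hM' K hK
        rw [add_assoc, hi', ← odometerScale_succ hQ, expansion_scale hQ (by omega),
          expansion_scale hQ (by omega)]

/-- The digit `j` of the image is computed from finitely many digits of `x`; membership in the
closed set `Ω_Q` passes from the dense set of expansions. -/
theorem exists_continuous_extension {Q : ℕ → ℕ} (hQ : ∀ k, 1 ≤ k → Q k ≤ k - 1)
    (hlim : Tendsto Q atTop atTop) :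
    ∃ T : OdometerSpace Q → OdometerSpace Q, Continuous T ∧
      ∀ n, T (expansion Q n) = expansion Q (n + 1) := by
  choose μ hμ hμ' using exists_forall_le_of_tendsto hlim
  let T : OdometerSpace Q → ℕ → Bool := fun x j =>
    (expansion Q (truncation Q x (μ (j + 1)) + 1) : ℕ → Bool) j
  have hTc : Continuous T := continuous_pi fun j =>
    OdometerSpace.continuous_of_digits (μ (j + 1)) fun x y h => by
      simp only [T]
      rw [truncation_congr h]
  have hTe : ∀ n, T (expansion Q n) = expansion Q (n + 1) := fun n => funext fun j =>
    (expansion_succ_apply hQ (hμ (j + 1)) (hμ' (j + 1)) n (Nat.lt_succ_self j)).symm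
  have hmem : ∀ x, T x ∈ odometerSet Q := fun x =>
    (denseRange_expansion hQ).induction_on x ((isClosed_odometerSet Q).preimage hTc) fun n => by
      rw [hTe]
      exact (expansion Q (n + 1)).2
  exact ⟨fun x => ⟨T x, hmem x⟩, hTc.subtype_mk hmem, fun n => Subtype.ext (hTe n)⟩

theorem odometerMap_eq {Q : ℕ → ℕ} (hQ : ∀ k, 1 ≤ k → Q k ≤ k - 1)
    {T : OdometerSpace Q → OdometerSpace Q} (hT : Continuous T)
    (hTe : ∀ n, T (expansion Q n) = expansion Q (n + 1)) : odometerMap Q = T := by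
  funext x
  have hne : (comap (expansion Q) (𝓝 x)).NeBot := 
    comap_neBot_iff_frequently.mpr
      (mem_closure_iff_frequently.mp (denseRange_expansion hQ x))
  refine Tendsto.limUnder_eq ?_
  simp only [← hTe]
  exact (hT.tendsto x).comp tendsto_comap

theorem continuous_odometerMap {Q : ℕ → ℕ} (hQ : ∀ k, 1 ≤ k → Q k ≤ k - 1)
    (hlim : Tendsto Q atTop atTop) : Continuous (odometerMap Q) := by
  obtain ⟨T, hT, hTe⟩ := exists_continuous_extension hQ hlim
  rwa [odometerMap_eq hQ hT hTe]

theorem odometerMap_expansion {Q : ℕ → ℕ} (hQ : ∀ k, 1 ≤ k → Q k ≤ k - 1)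
    (hlim : Tendsto Q atTop atTop) (n : ℕ) :
    odometerMap Q (expansion Q n) = expansion Q (n + 1) := by
  obtain ⟨T, hT, hTe⟩ := exists_continuous_extension hQ hlim
  rw [odometerMap_eq hQ hT hTe, hTe]

theorem odometerMap_iterate_expansion {Q : ℕ → ℕ} (hQ : ∀ k, 1 ≤ k → Q k ≤ k - 1)
    (hlim : Tendsto Q atTop atTop) (n i : ℕ) :
    (odometerMap Q)^[i] (expansion Q n) = expansion Q (n + i) := by
  induction i with
  | zero => simp
  | succ i ih => rw [Function.iterate_succ_apply', ih, odometerMap_expansion hQ hlim, add_assoc]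

theorem surjective_odometerMap {Q : ℕ → ℕ} (hQ : ∀ k, 1 ≤ k → Q k ≤ k - 1)
    (hlim : Tendsto Q atTop atTop) : Function.Surjective (odometerMap Q) := by
  have hcl : IsClosed (Set.range (odometerMap Q)) :=
    (isCompact_range (continuous_odometerMap hQ hlim)).isClosed
  have hmem : ∀ n, expansion Q n ∈ Set.range (odometerMap Q) := by
    have hsucc : ∀ n, expansion Q (n + 1) ∈ Set.range (odometerMap Q) := fun n =>
      ⟨_, odometerMap_expansion hQ hlim n⟩
    rintro (_ | n)
    -- `⟨0⟩` is not the image of an expansion by the formula; it is reached as the limit of `⟨S k⟩`.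
    · refine hcl.mem_of_tendsto (tendsto_expansion_scale hQ) (Eventually.of_forall fun k => ?_)
      have h := odometerScale_pos hQ k
      obtain ⟨m, hm⟩ := Nat.exists_eq_succ_of_ne_zero h.ne'
      simp only [hm]
      exact hsucc m
    · exact hsucc n
  exact fun x => (denseRange_expansion hQ).induction_on (p := (· ∈ Set.range (odometerMap Q)))
    x hcl hmem

/-- The bound `S M` on the return time does not depend on `N`; this is what lets the statement pass
to the closure of the expansions. -/
theorem exists_add_digits_eq_false {Q : ℕ → ℕ} (hQ : ∀ k, 1 ≤ k → Q k ≤ k - 1) (M N : ℕ) :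
    ∃ i ≤ odometerScale Q M, ∀ j < M, (expansion Q (N + i) : ℕ → Bool) j = false := by
  induction N using Nat.strong_induction_on with
  | _ N ih =>
    rcases lt_or_ge N (odometerScale Q M) with hN | hN
    · refine ⟨odometerScale Q M - N, by omega, fun j hj => ?_⟩
      rw [Nat.add_sub_cancel' hN.le, expansion_scale hQ (by omega)]
    · obtain ⟨K, r, hK, rfl, hr⟩ := exists_leading_digit hQ hN
      have hpos := odometerScale_pos hQ K
      obtain ⟨i, hi, h⟩ := ih r (by omega)
      rcases lt_or_ge (r + i) (odometerScale Q (Q (K + 1))) with hlt | hge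
      · refine ⟨i, hi, fun j hj => ?_⟩
        rw [add_assoc, expansion_scale_add_apply_of_ne hQ hlt (by omega), h j hj]
      -- The carry into `S (K + 1)` happens within the first `i` steps, and it already clears the
      -- first `M` digits.
      · refine ⟨odometerScale Q (Q (K + 1)) - r, by omega, fun j hj => ?_⟩
        rw [add_assoc, Nat.add_sub_cancel' hr.le, ← odometerScale_succ hQ,
          expansion_scale hQ (by omega)]

theorem exists_iterate_digits_eq_false {Q : ℕ → ℕ} (hQ : ∀ k, 1 ≤ k → Q k ≤ k - 1)
    (hlim : Tendsto Q atTop atTop) (M : ℕ) (x : OdometerSpace Q) :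
    ∃ i, ∀ j < M, ((odometerMap Q)^[i] x : ℕ → Bool) j = false := by
  have hcl : IsClosed {x : OdometerSpace Q | ∃ i ∈ Set.Iic (odometerScale Q M), ∀ j < M,
      ((odometerMap Q)^[i] x : ℕ → Bool) j = false} := by
    have : {x : OdometerSpace Q | ∃ i ∈ Set.Iic (odometerScale Q M), ∀ j < M,
        ((odometerMap Q)^[i] x : ℕ → Bool) j = false} =
        ⋃ i ∈ Set.Iic (odometerScale Q M), ⋂ j, ⋂ _ : j < M, {x : OdometerSpace Q |
          ((odometerMap Q)^[i] x : ℕ → Bool) j = false} := by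
      ext x
      simp
    rw [this]
    refine (Set.finite_Iic _).isClosed_biUnion fun i _ => isClosed_iInter fun j =>
      isClosed_iInter fun _ => isClosed_eq ?_ continuous_const
    exact (continuous_apply j).comp (continuous_subtype_val.comp
      ((continuous_odometerMap hQ hlim).iterate i))
  have h := (denseRange_expansion hQ).induction_on
    (p := fun x => ∃ i ∈ Set.Iic (odometerScale Q M), ∀ j < M,
      ((odometerMap Q)^[i] x : ℕ → Bool) j = false) x hcl fun N => by
    obtain ⟨i, hi, h⟩ := exists_add_digits_eq_false hQ M N
    exact ⟨i, hi, fun j hj => by rw [odometerMap_iterate_expansion hQ hlim, h j hj]⟩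
  obtain ⟨i, -, hi⟩ := h
  exact ⟨i, hi⟩

/-- Every orbit accumulates at `⟨0⟩`, and the orbit of `⟨0⟩` consists of all expansions, which are
dense. -/
theorem dense_range_iterate_odometerMap {Q : ℕ → ℕ} (hQ : ∀ k, 1 ≤ k → Q k ≤ k - 1)
    (hlim : Tendsto Q atTop atTop) (x : OdometerSpace Q) :
    Dense (Set.range fun n : ℕ => (odometerMap Q)^[n] x) := by
  set O := Set.range fun n : ℕ => (odometerMap Q)^[n] x with hO
  have h0 : expansion Q 0 ∈ closure O := by
    choose i hi using fun M => exists_iterate_digits_eq_false hQ hlim M x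
    refine mem_closure_of_tendsto (f := fun M => (odometerMap Q)^[i M] x) (b := atTop)
      (OdometerSpace.tendsto_of_digits fun k => ?_)
      (Eventually.of_forall fun M => Set.mem_range_self _)
    filter_upwards [eventually_gt_atTop k] with M hM
    rw [hi M k hM, expansion_zero hQ]
  have hmaps : Set.MapsTo (odometerMap Q) (closure O) (closure O) := by
    refine Set.MapsTo.closure ?_ (continuous_odometerMap hQ hlim)
    rintro _ ⟨n, rfl⟩
    exact ⟨n + 1, Function.iterate_succ_apply' _ _ _⟩
  have hn : ∀ n, expansion Q n ∈ closure O := by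
    intro n
    induction n with
    | zero => exact h0
    | succ n ih =>
      rw [← odometerMap_expansion hQ hlim]
      exact hmaps ih
  exact fun y => (denseRange_expansion hQ).induction_on (p := (· ∈ closure O)) y
    isClosed_closure hn

theorem isCantorSet_odometerSpace {Q : ℕ → ℕ} (hQ : ∀ k, 1 ≤ k → Q k ≤ k - 1)
    (hlim : Tendsto Q atTop atTop) : IsCantorSet (OdometerSpace Q) where
  nonempty := inferInstance
  compact := inferInstance
  metrizable := inferInstance
  totallyDisconnected := inferInstance
  perfect := by
    refine ⟨preperfect_iff_nhds.mpr fun x _ U hU => ?_⟩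
    -- The points `⟨n + S k⟩` converge to `⟨n⟩` and are pairwise distinct, so at most one of them is
    -- `x`; no case distinction on `x = ⟨n⟩` is needed.
    have hdense : ∀ n, ∃ᶠ k in atTop, expansion Q (n + odometerScale Q k) ∈ ({x}ᶜ : Set _) := by
      intro n
      rw [Filter.frequently_atTop]
      intro a
      by_contra! hc
      have h1 := hc a le_rfl
      have h2 := hc (a + 1) (by omega)
      simp only [Set.mem_compl_iff, Set.mem_singleton_iff, not_not] at h1 h2
      have h3 : n + odometerScale Q a = n + odometerScale Q (a + 1) := by
        have hb : ∀ i, i < odometerScale Q i := lt_odometerScale hQ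
        set a₁ := n + odometerScale Q a
        set a₂ := n + odometerScale Q (a + 1)
        have e1 := truncation_expansion hQ (m := max a₁ a₂) ((hb a₁).trans_le
          ((odometerScale_strictMono hQ).monotone (le_max_left a₁ a₂)))
        have e2 := truncation_expansion hQ (m := max a₁ a₂) ((hb a₂).trans_le
          ((odometerScale_strictMono hQ).monotone (le_max_right a₁ a₂)))
        rw [h1] at e1
        rw [h2] at e2
        exact e1.symm.trans e2
      have := odometerScale_strictMono hQ (Nat.lt_add_one a)
      omega
    obtain ⟨n, hn⟩ := (denseRange_expansion hQ).exists_mem_open isOpen_interior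
      ⟨x, mem_interior_iff_mem_nhds.mpr hU⟩
    have hlim' : Tendsto (fun k => expansion Q (n + odometerScale Q k)) atTop
        (𝓝 (expansion Q n)) := by
      have hS : ∀ᶠ k in atTop, n < odometerScale Q (Q (k + 1)) := by
        filter_upwards [(hlim.comp (tendsto_add_atTop_nat 1)).eventually_ge_atTop n] with k hk
        exact (lt_odometerScale hQ n).trans_le ((odometerScale_strictMono hQ).monotone hk)
      refine OdometerSpace.tendsto_of_digits fun j => ?_
      filter_upwards [hS, eventually_gt_atTop j] with k hk hjk
      rw [add_comm, expansion_scale_add_apply_of_ne hQ hk (by omega)]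
    obtain ⟨k, hk1, hk2⟩ := ((hdense n).and_eventually
      (hlim'.eventually_mem (isOpen_interior.mem_nhds hn))).exists
    exact ⟨_, ⟨interior_subset hk2, Set.mem_univ _⟩, hk1⟩

theorem isMinimalCantorSystem_odometerMap {Q : ℕ → ℕ} (hQ : ∀ k, 1 ≤ k → Q k ≤ k - 1)
    (hlim : Tendsto Q atTop atTop) :
    IsMinimalCantorSystem (OdometerSpace Q) (odometerMap Q) where
  cantor := isCantorSet_odometerSpace hQ hlim
  continuous := continuous_odometerMap hQ hlim
  surjective := surjective_odometerMap hQ hlim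
  minimal := dense_range_iterate_odometerMap hQ hlim

/-! ## Sums along the orbit of `⟨0⟩` -/

/-- The sum of `f` over the first `n` points of the orbit of `⟨0⟩`. -/
noncomputable def orbitSum {Q : ℕ → ℕ} (f : OdometerSpace Q → ℤ) (n : ℕ) : ℤ :=
  ∑ i ∈ Finset.range n, f (expansion Q i)

/-- The recursion of the scale, from the index `K` on. -/
def IsRecursiveFrom (Q : ℕ → ℕ) (K : ℕ) (g : ℕ → ℤ) : Prop :=
  ∀ k, K ≤ k → g (k + 1) = g k + g (Q (k + 1))

theorem IsRecursiveFrom.mono {Q : ℕ → ℕ} {K K' : ℕ} {g : ℕ → ℤ} (h : IsRecursiveFrom Q K g)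
    (hK : K ≤ K') : IsRecursiveFrom Q K' g :=
  fun k hk => h k (hK.trans hk)

/-- The points `⟨S K + j⟩` and `⟨j⟩` agree on the first `M` digits for `j < S (Q (K + 1))`; equality
is allowed for `i` because the sum stops at `i - 1`. -/
theorem orbitSum_scale_add {Q : ℕ → ℕ} (hQ : ∀ k, 1 ≤ k → Q k ≤ k - 1)
    {f : OdometerSpace Q → ℤ} {M K i : ℕ}
    (hf : ∀ x y : OdometerSpace Q, (∀ k < M, (x : ℕ → Bool) k = (y : ℕ → Bool) k) → f x = f y)
    (hK : M ≤ K) (hi : i ≤ odometerScale Q (Q (K + 1))) :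
    orbitSum f (odometerScale Q K + i) = orbitSum f (odometerScale Q K) + orbitSum f i := by
  rw [orbitSum, Finset.sum_range_add]
  refine congrArg₂ _ rfl (Finset.sum_congr rfl fun j hj => hf _ _ fun k hk => ?_)
  rw [Finset.mem_range] at hj
  exact expansion_scale_add_apply_of_ne hQ (by omega) (by omega)

theorem isRecursiveFrom_orbitSum {Q : ℕ → ℕ} (hQ : ∀ k, 1 ≤ k → Q k ≤ k - 1)
    {f : OdometerSpace Q → ℤ} {M : ℕ}
    (hf : ∀ x y : OdometerSpace Q, (∀ k < M, (x : ℕ → Bool) k = (y : ℕ → Bool) k) → f x = f y) :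
    IsRecursiveFrom Q M fun k => orbitSum f (odometerScale Q k) := fun k hk => by
  simp only
  rw [odometerScale_succ hQ, orbitSum_scale_add hQ hf hk le_rfl]

theorem orbitSum_coboundary {Q : ℕ → ℕ} (hQ : ∀ k, 1 ≤ k → Q k ≤ k - 1)
    (hlim : Tendsto Q atTop atTop) {f : C(OdometerSpace Q, ℤ)}
    (hf : f ∈ coboundaries (odometerMap Q)) :
    ∀ᶠ k in atTop, orbitSum f (odometerScale Q k) = 0 := by
  obtain ⟨h, hh⟩ := hf
  have hsum : ∀ n, orbitSum f n = h (expansion Q 0) - h (expansion Q n) := by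
    intro n
    induction n with
    | zero => simp [orbitSum]
    | succ n ih =>
      have hs : orbitSum f (n + 1) = orbitSum f n + f (expansion Q n) := Finset.sum_range_succ _ _
      rw [hs, ih, hh, odometerMap_expansion hQ hlim]
      ring
  obtain ⟨M, hM⟩ := OdometerSpace.exists_digits h
  filter_upwards [eventually_ge_atTop M] with k hk
  rw [hsum, sub_eq_zero]
  refine hM _ _ fun j hj => ?_
  rw [expansion_zero hQ, expansion_scale hQ (by omega)]

/-- Since the sums over full scale lengths vanish, leading digits at places `≥ M` can be stripped,
and `orbitSum f n` depends only on the first `M` digits of `⟨n⟩`. Its negative therefore extends to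
a continuous transfer function. -/
theorem mem_coboundaries_of_orbitSum_eq_zero {Q : ℕ → ℕ} (hQ : ∀ k, 1 ≤ k → Q k ≤ k - 1)
    (hlim : Tendsto Q atTop atTop) {f : C(OdometerSpace Q, ℤ)}
    (hf : ∀ᶠ k in atTop, orbitSum f (odometerScale Q k) = 0) :
    f ∈ coboundaries (odometerMap Q) := by
  obtain ⟨M₀, hM₀⟩ := OdometerSpace.exists_digits f
  obtain ⟨M₁, hM₁⟩ := eventually_atTop.mp hf
  set M := max M₀ M₁
  have hM : ∀ x y : OdometerSpace Q, (∀ k < M, (x : ℕ → Bool) k = (y : ℕ → Bool) k) →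
      f x = f y := fun x y h => hM₀ x y fun k hk => h k (lt_max_of_lt_left hk)
  have hsum : ∀ n, orbitSum f n = orbitSum f (truncation Q (expansion Q n) M) := by
    intro n
    induction n using Nat.strong_induction_on with
    | _ n ih =>
      rcases lt_or_ge n (odometerScale Q M) with hn | hn
      · rw [truncation_expansion hQ hn]
      · obtain ⟨K, i, hK, rfl, hi⟩ := exists_leading_digit hQ hn
        have hpos := odometerScale_pos hQ K
        have htr : truncation Q (expansion Q (odometerScale Q K + i)) M =
            truncation Q (expansion Q i) M :=
          truncation_congr fun k hk => expansion_scale_add_apply_of_ne hQ hi (by omega)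
        rw [orbitSum_scale_add hQ hM hK hi.le, hM₁ K ((le_max_right _ _).trans hK), zero_add, htr]
        exact ih i (by omega)
  have hc : Continuous fun x : OdometerSpace Q => -orbitSum f (truncation Q x M) :=
    OdometerSpace.continuous_of_digits M fun x y h => by rw [truncation_congr h]
  refine ⟨⟨_, hc⟩, fun x => ?_⟩
  refine (denseRange_expansion hQ).induction_on x (isClosed_eq f.continuous
    (hc.sub (hc.comp (continuous_odometerMap hQ hlim)))) fun n => ?_
  have hs : orbitSum f (n + 1) = orbitSum f n + f (expansion Q n) := Finset.sum_range_succ _ _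
  simp only [ContinuousMap.coe_mk]
  rw [odometerMap_expansion hQ hlim, ← hsum, ← hsum, hs]
  ring

theorem exists_digit_eq_true {Q : ℕ → ℕ} (hQ : ∀ k, 1 ≤ k → Q k ≤ k - 1) {i m : ℕ} (hi : 0 < i)
    (him : i < odometerScale Q m) : ∃ k < m, (expansion Q i : ℕ → Bool) k = true := by
  by_contra! hc
  have h := truncation_expansion hQ him
  have h0 : truncation Q (expansion Q i) m = 0 :=
    Finset.sum_eq_zero fun k hk => by
      have := hc k (Finset.mem_range.mp hk)
      simp only [ne_eq, Bool.not_eq_true] at this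
      simp [this]
  omega

/-- The function is supported where the first `m` digits vanish. There it puts the mass `g m` at
`⟨0⟩`, and at `⟨S k⟩` the increment `g (Q (k + 1))` if `Q (k + 1) ≤ m`; if `Q (k + 1) > m`, the
value `g m` makes the added stretch of orbit repeat the initial one. -/
theorem exists_orbitSum_eq {Q : ℕ → ℕ} (hQ : ∀ k, 1 ≤ k → Q k ≤ k - 1)
    (hlim : Tendsto Q atTop atTop) {m : ℕ} {g : ℕ → ℤ} (hg : IsRecursiveFrom Q m g)
    (hpos : ∀ k, 0 ≤ g k) :
    ∃ f : C(OdometerSpace Q, ℤ), (∀ x, 0 ≤ f x) ∧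
      ∀ k, m ≤ k → orbitSum f (odometerScale Q k) = g k := by
  classical
  obtain ⟨M, hmM, hM⟩ := exists_forall_le_of_tendsto hlim m
  -- `c x` is the first place `≥ m` with digit `1`, capped at `M`. The cap makes `f` depend on
  -- finitely many digits and is harmless: from `M` on, `min m (Q (k + 1)) = m`.
  let c : OdometerSpace Q → ℕ := fun x => sInf {k | m ≤ k ∧ (x : ℕ → Bool) k = true ∨ M ≤ k}
  let f : OdometerSpace Q → ℤ := fun x =>
    if ∃ k < m, (x : ℕ → Bool) k = true then 0 else g (min m (Q (c x + 1)))
  have hcongr : ∀ {x y : OdometerSpace Q} {N : ℕ},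
      (∃ k < N, m ≤ k ∧ (x : ℕ → Bool) k = true ∨ M ≤ k) → m ≤ N →
      (∀ k < N, (x : ℕ → Bool) k = (y : ℕ → Bool) k) → f x = f y := by
    intro x y N hN hmN h
    have h1 : (∃ k < m, (x : ℕ → Bool) k = true) ↔ ∃ k < m, (y : ℕ → Bool) k = true :=
      exists_congr fun k => and_congr_right fun hk => by rw [h k (by omega)]
    have h2 : c x = c y := by
      obtain ⟨k, hk, hk'⟩ := hN
      have hx := Nat.sInf_mem (s := {k | m ≤ k ∧ (x : ℕ → Bool) k = true ∨ M ≤ k}) ⟨k, hk'⟩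
      have hxk : c x ≤ k := Nat.sInf_le hk'
      have hy := Nat.sInf_mem (s := {k | m ≤ k ∧ (y : ℕ → Bool) k = true ∨ M ≤ k})
        ⟨M, Or.inr le_rfl⟩
      have hyx : c y ≤ c x := Nat.sInf_le (by
        have := h (c x) (by omega)
        change m ≤ c x ∧ _ ∨ M ≤ c x at hx
        rw [this] at hx
        exact hx)
      refine le_antisymm (Nat.sInf_le ?_) hyx
      have := h (c y) (by omega)
      change m ≤ c y ∧ _ ∨ M ≤ c y at hy
      rw [← this] at hy
      exact hy
    simp only [f, h1, h2]
  have hcont : Continuous f := OdometerSpace.continuous_of_digits (M + 1) fun x y h =>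
    hcongr ⟨M, by omega, Or.inr le_rfl⟩ (by omega) h
  have hf0 : f (expansion Q 0) = g m := by
    have h1 : ¬ ∃ k < m, (expansion Q 0 : ℕ → Bool) k = true := by simp [expansion_zero hQ]
    have h2 : M ≤ c (expansion Q 0) := by
      have := Nat.sInf_mem (s := {k | m ≤ k ∧ (expansion Q 0 : ℕ → Bool) k = true ∨ M ≤ k})
        ⟨M, Or.inr le_rfl⟩
      change m ≤ c (expansion Q 0) ∧ _ ∨ M ≤ c (expansion Q 0) at this
      simpa [expansion_zero hQ] using this
    simp only [f, if_neg h1, min_eq_left (hM _ h2)]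
  have hfS : ∀ k, m ≤ k → f (expansion Q (odometerScale Q k)) = g (min m (Q (k + 1))) := by
    intro k hk
    have h1 : ¬ ∃ j < m, (expansion Q (odometerScale Q k) : ℕ → Bool) j = true := by
      rintro ⟨j, hj, hj'⟩
      rw [expansion_scale hQ (by omega)] at hj'
      simp at hj'
    have hkk : (expansion Q (odometerScale Q k) : ℕ → Bool) k = true := by
      have := expansion_scale_add hQ (K := k) (i := 0) (odometerScale_pos hQ _)
      rw [add_zero] at this
      rw [this, Function.update_self]
    have h2 := Nat.sInf_mem (s := {j | m ≤ j ∧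
      (expansion Q (odometerScale Q k) : ℕ → Bool) j = true ∨ M ≤ j}) ⟨k, Or.inl ⟨hk, hkk⟩⟩
    have h3 : c (expansion Q (odometerScale Q k)) ≤ k := Nat.sInf_le (Or.inl ⟨hk, hkk⟩)
    simp only [f, if_neg h1]
    set b := c (expansion Q (odometerScale Q k))
    change m ≤ b ∧ _ ∨ M ≤ b at h2
    rcases h2 with h2 | h2
    · have : b = k := by
        by_contra hne
        rw [expansion_scale hQ hne] at h2
        simp at h2
      rw [this]
    · rw [min_eq_left (hM _ h2), min_eq_left (hM _ (h2.trans h3))]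
  have hfzero : ∀ i, 0 < i → i < odometerScale Q m → f (expansion Q i) = 0 := fun i hi him =>
    if_pos (exists_digit_eq_true hQ hi him)
  have hmono := (odometerScale_strictMono hQ).monotone
  have hfadd : ∀ k i, m ≤ k → 0 < i → i < odometerScale Q (Q (k + 1)) →
      f (expansion Q (odometerScale Q k + i)) = f (expansion Q i) := by
    intro k i hk hi hik
    have hQk : Q (k + 1) ≤ k := by simpa using hQ (k + 1) (by omega)
    obtain ⟨j, hj, hij⟩ := exists_digit_eq_true hQ hi hik
    have heq : ∀ j < k, (expansion Q (odometerScale Q k + i) : ℕ → Bool) j =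
        (expansion Q i : ℕ → Bool) j := fun j hj =>
      expansion_scale_add_apply_of_ne hQ hik (by omega)
    rcases lt_or_ge j m with hjm | hjm
    · have h1 : f (expansion Q i) = 0 := if_pos ⟨j, hjm, hij⟩
      rw [h1]
      exact if_pos ⟨j, hjm, by rw [heq j (by omega), hij]⟩
    · refine hcongr (N := k) ⟨j, by omega, Or.inl ⟨hjm, ?_⟩⟩ hk heq
      rw [heq j (by omega), hij]
  refine ⟨⟨f, hcont⟩, fun x => ?_, fun k hk => ?_⟩
  · simp only [ContinuousMap.coe_mk, f]
    split_ifs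
    exacts [le_rfl, hpos _]
  · simp only [ContinuousMap.coe_mk]
    induction k using Nat.strong_induction_on with
    | _ k ih =>
      rcases hk.eq_or_lt with rfl | hlt
      · rw [orbitSum, Finset.sum_eq_single_of_mem 0
          (Finset.mem_range.mpr (odometerScale_pos hQ _)) fun i hi hi0 =>
            hfzero i (Nat.pos_of_ne_zero hi0) (Finset.mem_range.mp hi), hf0]
      · obtain ⟨k, rfl⟩ : ∃ l, k = l + 1 := ⟨k - 1, by omega⟩
        have hmk : m ≤ k := by omega
        have hQk : Q (k + 1) ≤ k := by simpa using hQ (k + 1) (by omega)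
        rw [hg k hmk, ← ih k (by omega) hmk, odometerScale_succ hQ, orbitSum, orbitSum,
          Finset.sum_range_add, add_right_inj]
        rcases le_or_gt (Q (k + 1)) m with hle | hgt
        · rw [Finset.sum_eq_single_of_mem 0
            (Finset.mem_range.mpr (odometerScale_pos hQ _)) fun i hi hi0 => ?_, add_zero,
            hfS k hmk, min_eq_right hle]
          rw [Finset.mem_range] at hi
          rw [hfadd k i hmk (Nat.pos_of_ne_zero hi0) hi,
            hfzero i (Nat.pos_of_ne_zero hi0) (hi.trans_le (hmono hle))]
        · rw [← ih _ (by omega) hgt.le]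
          refine Finset.sum_congr rfl fun i hi => ?_
          rw [Finset.mem_range] at hi
          rcases Nat.eq_zero_or_pos i with rfl | hi0
          · rw [add_zero, hfS k hmk, min_eq_left hgt.le, hf0]
          · exact hfadd k i hmk hi0 hi

/-! ## Weights and the state they define -/

/-- The value of the functional with weights `A` on `g`, computed from the window of indices
preceding `k`; the index `N` bounds the sum. -/
def windowValue (Q : ℕ → ℕ) (A : ℕ → ℝ) (N k : ℕ) (g : ℕ → ℤ) : ℝ :=
  A k * g k + ∑ i ∈ Finset.Ioc k N, if Q i < k then A i * g (Q i) else 0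

/-- `v` is the value on `g` of the functional with weights `A`. -/
def HasValue (Q : ℕ → ℕ) (A : ℕ → ℝ) (g : ℕ → ℤ) (v : ℝ) : Prop :=
  ∀ᶠ k in atTop, ∀ᶠ N in atTop, windowValue Q A N k g = v

/-- The weights `A` are balanced: `A k = A (k + 1) + ∑ A i`, the sum being over all `i ≥ 1` such
that `Q i = k`. -/
def IsBalanced (Q : ℕ → ℕ) (A : ℕ → ℝ) : Prop :=
  ∀ k, ∀ᶠ N in atTop, A k = A (k + 1) + ∑ i ∈ Finset.Ioc 0 N, if Q i = k then A i else 0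

theorem IncreasingModuloIntervals.tendsto {Q : ℕ → ℕ} (h : IncreasingModuloIntervals Q) :
    Tendsto Q atTop atTop := by
  obtain ⟨-, q, hq, -, -, hQ⟩ := h
  refine tendsto_atTop.mpr fun b => ?_
  filter_upwards [eventually_ge_atTop (q (b + 1))] with k hk
  have hex : ∃ n, k < q (n + 2) := ⟨k, lt_of_lt_of_le (by omega : k < k + 2) (hq.id_le (k + 2))⟩
  classical
  have hlt := Nat.find_spec hex
  have hb : b ≤ Nat.find hex := by
    have := hq.lt_iff_lt.mp (hk.trans_lt hlt)
    omega
  have hle : q (Nat.find hex + 1) ≤ k := by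
    rcases Nat.eq_zero_or_pos (Nat.find hex) with h0 | h0
    · have : b = 0 := by omega
      rwa [h0, ← this]
    · have := Nat.find_min hex (Nat.sub_lt h0 one_pos)
      have e : Nat.find hex - 1 + 2 = Nat.find hex + 1 := by omega
      rw [e] at this
      omega
  exact (hb.trans (hq.id_le _)).trans (hQ _ k hle hlt).1

/-- Passing from `k` to `k + 1` drops the index `k + 1` from the sum and adds those with `Q i = k`.
The recursion of `g` accounts for the former, the balance at `k` for the latter. -/
theorem windowValue_succ {Q : ℕ → ℕ} (hQ : ∀ k, 1 ≤ k → Q k ≤ k - 1) {A : ℕ → ℝ} {N k : ℕ}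
    {g : ℕ → ℤ} (hN : k < N) (hg : g (k + 1) = g k + g (Q (k + 1)))
    (hA : A k = A (k + 1) + ∑ i ∈ Finset.Ioc 0 N, if Q i = k then A i else 0) :
    windowValue Q A N (k + 1) g = windowValue Q A N k g := by
  have hsplit : ∀ F : ℕ → ℝ, ∑ i ∈ Finset.Ioc k N, F i =
      F (k + 1) + ∑ i ∈ Finset.Ioc (k + 1) N, F i := fun F => by
    rw [← Finset.sum_Ioc_consecutive F (Nat.le_succ k) (by omega : k + 1 ≤ N)]
    simp
  have hQk : Q (k + 1) ≤ k := by simpa using hQ (k + 1) (by omega)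
  have h0 : ∑ i ∈ Finset.Ioc 0 k, (if Q i = k then A i else 0) = 0 :=
    Finset.sum_eq_zero fun i hi => if_neg fun h => by
      rw [Finset.mem_Ioc] at hi
      have := hQ i (by omega)
      omega
  have h1 : ∑ i ∈ Finset.Ioc (k + 1) N, (if Q i < k + 1 then A i * (g (Q i) : ℝ) else 0) =
      (∑ i ∈ Finset.Ioc (k + 1) N, if Q i < k then A i * (g (Q i) : ℝ) else 0) +
        (∑ i ∈ Finset.Ioc (k + 1) N, if Q i = k then A i else 0) * g k := by
    rw [Finset.sum_mul, ← Finset.sum_add_distrib]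
    refine Finset.sum_congr rfl fun i _ => ?_
    rcases lt_trichotomy (Q i) k with h | h | h
    · rw [if_pos (by omega), if_pos h, if_neg h.ne, zero_mul, add_zero]
    · rw [if_pos (by omega), if_neg (by omega), if_pos h, h, zero_add]
    · rw [if_neg (by omega), if_neg (by omega), if_neg (by omega), zero_mul, add_zero]
  rw [← Finset.sum_Ioc_consecutive _ (Nat.zero_le k) hN.le, h0, zero_add, hsplit] at hA
  rw [windowValue, windowValue, h1, hsplit fun i => if Q i < k then A i * (g (Q i) : ℝ) else 0,
    hg, hA]
  push_cast
  rcases hQk.lt_or_eq with h | h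
  · rw [if_pos h, if_neg h.ne]
    ring
  · rw [if_pos h, if_neg (by omega), h]
    ring

theorem IsRecursiveFrom.hasValue_iff {Q : ℕ → ℕ} (hQ : ∀ k, 1 ≤ k → Q k ≤ k - 1) {A : ℕ → ℝ}
    (hA : IsBalanced Q A) {K : ℕ} {g : ℕ → ℤ} (hg : IsRecursiveFrom Q K g) {v : ℝ} :
    HasValue Q A g v ↔ ∀ᶠ N in atTop, windowValue Q A N K g = v := by
  have key : ∀ k, K ≤ k → ((∀ᶠ N in atTop, windowValue Q A N k g = v) ↔
      ∀ᶠ N in atTop, windowValue Q A N K g = v) := by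
    intro k hk
    induction k, hk using Nat.le_induction with
    | base => rfl
    | succ k hk ih =>
      rw [← ih]
      refine eventually_congr ?_
      filter_upwards [hA k, eventually_gt_atTop k] with N hN hkN
      rw [windowValue_succ hQ hkN (hg k hk) hN]
  constructor
  · intro h
    obtain ⟨k, hk, hKk⟩ := (h.and (eventually_ge_atTop K)).exists
    exact (key k hKk).mp hk
  · intro h
    filter_upwards [eventually_ge_atTop K] with k hk using (key k hk).mpr h

/-- Only finitely many `i` have `Q i < k`, because `Q` tends to infinity. -/
theorem windowValue_eventually_const {Q : ℕ → ℕ} (hlim : Tendsto Q atTop atTop) (A : ℕ → ℝ)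
    (k : ℕ) (g : ℕ → ℤ) :
    ∃ v, ∀ᶠ N in atTop, windowValue Q A N k g = v := by
  obtain ⟨M, hM⟩ := eventually_atTop.mp (hlim.eventually_ge_atTop k)
  refine ⟨windowValue Q A (max k M) k g, ?_⟩
  filter_upwards [eventually_ge_atTop (max k M)] with N hN
  rw [windowValue, windowValue,
    ← Finset.sum_Ioc_consecutive _ (le_max_left k M) hN, add_right_inj, add_eq_left]
  refine Finset.sum_eq_zero fun i hi => if_neg ?_
  rw [Finset.mem_Ioc] at hi
  have := hM i (by omega)
  omega

theorem IsRecursiveFrom.exists_hasValue {Q : ℕ → ℕ} (hQ : ∀ k, 1 ≤ k → Q k ≤ k - 1)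
    (hlim : Tendsto Q atTop atTop) {A : ℕ → ℝ} (hA : IsBalanced Q A) {K : ℕ} {g : ℕ → ℤ}
    (hg : IsRecursiveFrom Q K g) : ∃ v, HasValue Q A g v := by
  obtain ⟨v, hv⟩ := windowValue_eventually_const hlim A K g
  exact ⟨v, (hg.hasValue_iff hQ hA).mpr hv⟩

theorem HasValue.unique {Q : ℕ → ℕ} {A : ℕ → ℝ} {g : ℕ → ℤ} {v w : ℝ}
    (hv : HasValue Q A g v) (hw : HasValue Q A g w) : v = w := by
  obtain ⟨k, h1, h2⟩ := (hv.and hw).exists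
  obtain ⟨N, h3, h4⟩ := (h1.and h2).exists
  exact h3.symm.trans h4

theorem HasValue.add {Q : ℕ → ℕ} {A : ℕ → ℝ} {g h : ℕ → ℤ} {v w : ℝ}
    (hv : HasValue Q A g v) (hw : HasValue Q A h w) : HasValue Q A (g + h) (v + w) := by
  filter_upwards [hv, hw] with k h1 h2
  filter_upwards [h1, h2] with N h3 h4
  rw [← h3, ← h4]
  simp only [windowValue, Pi.add_apply, Int.cast_add]
  rw [mul_add, add_add_add_comm, ← Finset.sum_add_distrib]
  refine congrArg₂ _ rfl (Finset.sum_congr rfl fun i _ => ?_)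
  split_ifs <;> ring

theorem HasValue.congr {Q : ℕ → ℕ} (hlim : Tendsto Q atTop atTop) {A : ℕ → ℝ} {g h : ℕ → ℤ}
    {v : ℝ} (hv : HasValue Q A g v) (hgh : ∀ᶠ k in atTop, g k = h k) : HasValue Q A h v := by
  obtain ⟨M, hM⟩ := eventually_atTop.mp hgh
  obtain ⟨M', hM'⟩ := eventually_atTop.mp (hlim.eventually_ge_atTop M)
  filter_upwards [hv, eventually_ge_atTop M, eventually_ge_atTop M'] with k h1 h2 h3
  filter_upwards [h1] with N hN
  rw [← hN, windowValue, windowValue, hM k h2]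
  refine congrArg₂ _ rfl (Finset.sum_congr rfl fun i hi => ?_)
  rw [Finset.mem_Ioc] at hi
  rw [hM _ (hM' i (by omega))]

theorem hasValue_zero {Q : ℕ → ℕ} {A : ℕ → ℝ} : HasValue Q A 0 0 :=
  Eventually.of_forall fun k => Eventually.of_forall fun N => by simp [windowValue]

theorem HasValue.nonneg {Q : ℕ → ℕ} {A : ℕ → ℝ} (hA : ∀ k, 0 < A k) {g : ℕ → ℤ}
    {v : ℝ} (hv : HasValue Q A g v) (hg : ∀ k, 0 ≤ g k) : 0 ≤ v := by
  obtain ⟨k, hk⟩ := hv.exists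
  obtain ⟨N, hN⟩ := hk.exists
  rw [← hN]
  refine add_nonneg (mul_nonneg (hA k).le (by exact_mod_cast hg k)) (Finset.sum_nonneg fun i _ => ?_)
  split_ifs
  · exact mul_nonneg (hA i).le (by exact_mod_cast hg _)
  · exact le_rfl

theorem HasValue.mem {Q : ℕ → ℕ} {A : ℕ → ℝ} {Γ : AddSubgroup ℝ} (hA : ∀ k, A k ∈ Γ) {g : ℕ → ℤ}
    {v : ℝ} (hv : HasValue Q A g v) : v ∈ Γ := by
  obtain ⟨k, hk⟩ := hv.exists
  obtain ⟨N, hN⟩ := hk.exists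
  have hmul : ∀ (i : ℕ) (z : ℤ), A i * z ∈ Γ := fun i z => by
    rw [mul_comm, ← zsmul_eq_mul]
    exact Γ.zsmul_mem (hA i) z
  rw [← hN]
  refine Γ.add_mem (hmul _ _) (Γ.sum_mem fun i _ => ?_)
  split_ifs
  exacts [hmul _ _, Γ.zero_mem]

/-! ## The ordered group of the odometer -/

theorem orbitSum_add {Q : ℕ → ℕ} (f g : OdometerSpace Q → ℤ) (n : ℕ) :
    orbitSum (f + g) n = orbitSum f n + orbitSum g n :=
  Finset.sum_add_distrib

theorem isUnitalOrderedGroup_of_addEquiv {G : Type*} [AddCommGroup G] {P : Set G} {u : G}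
    {Γ : AddSubgroup ℝ} (hone : (1 : ℝ) ∈ Γ) (φ : G ≃+ Γ) (hP : ∀ a, a ∈ P ↔ 0 ≤ (φ a : ℝ))
    (hu : φ u = ⟨1, hone⟩) : IsUnitalOrderedGroup G P u where
  cone :=
    { add_mem := fun a ha b hb => by
        rw [hP] at *
        rw [map_add]
        exact add_nonneg ha hb
      generates := fun g => by
        rcases le_total 0 (φ g : ℝ) with h | h
        · exact ⟨g, (hP g).mpr h, 0, (hP 0).mpr (by simp), (sub_zero g).symm⟩
        · refine ⟨0, (hP 0).mpr (by simp), -g, (hP _).mpr ?_, by simp⟩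
          rw [map_neg]
          simpa using h
      zero_mem := (hP 0).mpr (by simp)
      eq_zero := fun a ha hb => by
        rw [hP] at *
        rw [map_neg] at hb
        have hb' : (φ a : ℝ) ≤ 0 := by simpa using hb
        exact φ.map_eq_zero_iff.mp (Subtype.ext (le_antisymm hb' ha)) }
  unit_mem := (hP u).mpr (by rw [hu]; exact zero_le_one)
  unit_spec := fun g => by
    obtain ⟨n, hn⟩ := exists_nat_ge (φ g : ℝ)
    refine ⟨n + 1, n.succ_pos, (hP _).mpr ?_⟩
    rw [map_sub, map_nsmul, hu]
    simp
    linarith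

/-- Positivity of the weights makes the functional positive. Conversely, a class of value `≥ 0` has
the value of some non-negative function, and by injectivity it is the class of that function. -/
theorem exists_addEquiv_KZero {Q : ℕ → ℕ} (hQ : ∀ k, 1 ≤ k → Q k ≤ k - 1)
    (hlim : Tendsto Q atTop atTop) {A : ℕ → ℝ} {Γ : AddSubgroup ℝ} (hone : (1 : ℝ) ∈ Γ)
    (hA0 : A 0 = 1) (hAmem : ∀ k, A k ∈ Γ) (hApos : ∀ k, 0 < A k) (hA : IsBalanced Q A)
    (hinj : ∀ K g, IsRecursiveFrom Q K g → HasValue Q A g 0 → ∀ᶠ k in atTop, g k = 0)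
    (hsurj : ∀ γ ∈ Γ, 0 < γ → ∃ K g, IsRecursiveFrom Q K g ∧ (∀ k, 0 ≤ g k) ∧ HasValue Q A g γ) :
    ∃ φ : KZero (odometerMap Q) ≃+ Γ,
      (∀ a, a ∈ KZero.positive (odometerMap Q) ↔ 0 ≤ (φ a : ℝ)) ∧
      φ (KZero.unit (odometerMap Q)) = ⟨1, hone⟩ := by
  have hrec : ∀ f : C(OdometerSpace Q, ℤ),
      ∃ K, IsRecursiveFrom Q K fun k => orbitSum f (odometerScale Q k) := fun f => by
    obtain ⟨M, hM⟩ := OdometerSpace.exists_digits f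
    exact ⟨M, isRecursiveFrom_orbitSum hQ hM⟩
  have hex : ∀ f : C(OdometerSpace Q, ℤ),
      ∃ v, HasValue Q A (fun k => orbitSum f (odometerScale Q k)) v := fun f => by
    obtain ⟨K, hK⟩ := hrec f
    exact hK.exists_hasValue hQ hlim hA
  choose val hval using hex
  have hval_eq : ∀ {f : C(OdometerSpace Q, ℤ)} {v : ℝ}, HasValue Q A (fun k => orbitSum f (odometerScale Q k)) v → val f = v :=
    fun h => (hval _).unique h
  let ψ : C(OdometerSpace Q, ℤ) →+ Γ := AddMonoidHom.mk' (fun f => ⟨val f, (hval f).mem hAmem⟩)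
    fun f g => Subtype.ext <| hval_eq <| by
      have h := (hval f).add (hval g)
      have e : ((fun k => orbitSum f (odometerScale Q k)) +
          fun k => orbitSum g (odometerScale Q k)) =
          fun k => orbitSum (f + g : C(OdometerSpace Q, ℤ)) (odometerScale Q k) := by
        funext k
        exact (orbitSum_add f g _).symm
      rwa [e] at h
  have hψ : ∀ f, (ψ f : ℝ) = val f := fun f => rfl
  have hker : ψ.ker = coboundaries (odometerMap Q) := by
    ext f
    rw [AddMonoidHom.mem_ker]
    constructor
    · intro h
      obtain ⟨K, hK⟩ := hrec f
      have h0 : val f = 0 := congrArg Subtype.val h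
      have hv := hval f
      rw [h0] at hv
      exact mem_coboundaries_of_orbitSum_eq_zero hQ hlim (hinj K _ hK hv)
    · intro h
      refine Subtype.ext (hval_eq (hasValue_zero.congr hlim ?_))
      filter_upwards [orbitSum_coboundary hQ hlim h] with k hk using hk.symm
  have hpre : ∀ γ : Γ, 0 ≤ (γ : ℝ) → ∃ f, (∀ x, 0 ≤ f x) ∧ ψ f = γ := by
    intro γ hγ
    rcases hγ.eq_or_lt with h | h
    · exact ⟨0, fun _ => le_rfl, by rw [map_zero]; exact Subtype.ext h⟩
    · obtain ⟨K, g, hg, hg0, hgv⟩ := hsurj γ γ.2 h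
      obtain ⟨f, hf0, hf⟩ := exists_orbitSum_eq hQ hlim hg hg0
      refine ⟨f, hf0, Subtype.ext (hval_eq (hgv.congr hlim ?_))⟩
      filter_upwards [eventually_ge_atTop K] with k hk using (hf k hk).symm
  have hψsurj : Function.Surjective ψ := by
    intro γ
    rcases le_total 0 (γ : ℝ) with h | h
    · obtain ⟨f, -, hf⟩ := hpre γ h
      exact ⟨f, hf⟩
    · obtain ⟨f, -, hf⟩ := hpre (-γ) (by simpa using h)
      exact ⟨-f, by rw [map_neg, hf, neg_neg]⟩
  have hψnonneg : ∀ f : C(OdometerSpace Q, ℤ), (∀ x, 0 ≤ f x) → 0 ≤ (ψ f : ℝ) := fun f hf =>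
    (hval f).nonneg hApos fun k => Finset.sum_nonneg fun i _ => hf _
  let φ : KZero (odometerMap Q) ≃+ Γ :=
    (QuotientAddGroup.quotientAddEquivOfEq hker.symm).trans
      (QuotientAddGroup.quotientKerEquivOfSurjective ψ hψsurj)
  have hφ : ∀ f : C(OdometerSpace Q, ℤ), φ (QuotientAddGroup.mk f) = ψ f := fun f => rfl
  refine ⟨φ, fun a => ⟨?_, fun h => ?_⟩, ?_⟩
  · rintro ⟨f, hf, rfl⟩
    rw [hφ]
    exact hψnonneg f hf
  · obtain ⟨f, hf, hfa⟩ := hpre (φ a) h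
    exact ⟨f, hf, φ.injective (by rw [hφ, hfa])⟩
  · rw [KZero.unit, hφ]
    refine Subtype.ext (hval_eq ?_)
    have hS : (fun k => orbitSum (1 : C(OdometerSpace Q, ℤ)) (odometerScale Q k)) =
        fun k => (odometerScale Q k : ℤ) := by
      funext k
      simp [orbitSum]
    rw [hS]
    have hr : IsRecursiveFrom Q 0 fun k => (odometerScale Q k : ℤ) := fun k _ => by
      simp only
      rw [odometerScale_succ hQ]
      push_cast
      rfl
    refine (hr.hasValue_iff hQ hA).mpr (Eventually.of_forall fun N => ?_)
    -- The scale is recursive from `0` on, and at `k = 0` the condition `Q i < 0` empties the sum,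
    -- leaving `A 0 * S 0 = 1`.
    simp [windowValue, hA0, odometerScale_zero]

theorem main_of_weights {Γ : AddSubgroup ℝ} (hone : (1 : ℝ) ∈ Γ) {Q : ℕ → ℕ}
    (hinc : IncreasingModuloIntervals Q) {A : ℕ → ℝ}
    (hA0 : A 0 = 1) (hAmem : ∀ k, A k ∈ Γ) (hApos : ∀ k, 0 < A k) (hA : IsBalanced Q A)
    (hinj : ∀ K g, IsRecursiveFrom Q K g → HasValue Q A g 0 → ∀ᶠ k in atTop, g k = 0)
    (hsurj : ∀ γ ∈ Γ, 0 < γ → ∃ K g, IsRecursiveFrom Q K g ∧ (∀ k, 0 ≤ g k) ∧ HasValue Q A g γ) :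
    IsCantorSet (OdometerSpace Q) ∧
      (∀ n, odometerMap Q (expansion Q n) = expansion Q (n + 1)) ∧
      IsMinimalCantorSystem (OdometerSpace Q) (odometerMap Q) ∧
      IsUnitalOrderedGroup (KZero (odometerMap Q)) (KZero.positive (odometerMap Q))
        (KZero.unit (odometerMap Q)) ∧
      UnitalOrderedGroupIsomorphic
        (KZero (odometerMap Q)) (KZero.positive (odometerMap Q)) (KZero.unit (odometerMap Q))
        Γ {x : Γ | 0 ≤ (x : ℝ)} ⟨1, hone⟩ := by
  have hQ := hinc.le_pred
  have hlim := hinc.tendsto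
  obtain ⟨φ, hφ, hφ1⟩ :=
    exists_addEquiv_KZero hQ hlim hone hA0 hAmem hApos hA hinj hsurj
  refine ⟨isCantorSet_odometerSpace hQ hlim, odometerMap_expansion hQ hlim,
    isMinimalCantorSystem_odometerMap hQ hlim, isUnitalOrderedGroup_of_addEquiv hone φ hφ hφ1,
    φ, fun a ha => (hφ a).mp ha, fun b hb => (hφ _).mpr ?_, hφ1⟩
  rw [AddEquiv.apply_symm_apply]
  exact hb

/-! ## Positive bases of finitely generated groups of real numbers -/

/-- `f` is a family of positive elements of the group generated by `e`, and every `e i` is a sum of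
members of `f`. -/
structure Refines {ι : Type*} (e f : ι → ℝ) : Prop where
  pos : ∀ i, 0 < f i
  mem : ∀ i, f i ∈ AddSubgroup.closure (Set.range e)
  mem_cone : ∀ i, e i ∈ AddSubmonoid.closure (Set.range f)

theorem AddSubmonoid.closure_le_addSubgroupClosure (s : Set ℝ) :
    (AddSubmonoid.closure s : Set ℝ) ⊆ AddSubgroup.closure s :=
  fun _ hx => (AddSubmonoid.closure_le (S := (AddSubgroup.closure s).toAddSubmonoid)).mpr
    AddSubgroup.subset_closure hx

theorem self_mem_cone {ι : Type*} (f : ι → ℝ) (i : ι) : f i ∈ AddSubmonoid.closure (Set.range f) :=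
  AddSubmonoid.subset_closure ⟨i, rfl⟩

theorem nonneg_of_mem_cone {ι : Type*} {f : ι → ℝ} (hf : ∀ i, 0 < f i) {x : ℝ}
    (hx : x ∈ AddSubmonoid.closure (Set.range f)) : 0 ≤ x := by
  induction hx using AddSubmonoid.closure_induction with
  | mem x hx =>
    obtain ⟨i, rfl⟩ := hx
    exact (hf i).le
  | zero => exact le_rfl
  | add x y _ _ hx hy => exact add_nonneg hx hy

/-! ### Refinement preserves the group, enlarges the cone and keeps independence. -/

namespace Refines

variable {ι : Type*} {e f g : ι → ℝ}

protected theorem refl (he : ∀ i, 0 < e i) : Refines e e :=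
  ⟨he, fun i => AddSubgroup.subset_closure ⟨i, rfl⟩, self_mem_cone e⟩

theorem cone_le (h : Refines e f) :
    AddSubmonoid.closure (Set.range e) ≤ AddSubmonoid.closure (Set.range f) := by
  rw [AddSubmonoid.closure_le]
  rintro _ ⟨i, rfl⟩
  exact h.mem_cone i

theorem group_le (h : Refines e f) :
    AddSubgroup.closure (Set.range e) ≤ AddSubgroup.closure (Set.range f) := by
  rw [AddSubgroup.closure_le]
  rintro _ ⟨i, rfl⟩
  exact AddSubmonoid.closure_le_addSubgroupClosure _ (h.mem_cone i)

theorem group_ge (h : Refines e f) :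
    AddSubgroup.closure (Set.range f) ≤ AddSubgroup.closure (Set.range e) := by
  rw [AddSubgroup.closure_le]
  rintro _ ⟨i, rfl⟩
  exact h.mem i

theorem trans (h : Refines e f) (h' : Refines f g) : Refines e g :=
  ⟨h'.pos, fun i => h.group_ge (h'.mem i), fun i => h'.cone_le (h.mem_cone i)⟩

theorem linearIndependent [Fintype ι] (h : Refines e f) (he : LinearIndependent ℤ e) :
    LinearIndependent ℤ f := by
  rw [linearIndependent_iff_card_le_finrank_span] at he ⊢
  refine he.trans ?_
  have hfin : Module.Finite ℤ (Submodule.span ℤ (Set.range f)) :=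
    Module.Finite.span_of_finite ℤ (Set.finite_range f)
  refine Submodule.finrank_mono ?_
  rw [Submodule.span_le]
  rintro _ ⟨i, rfl⟩
  have := AddSubmonoid.closure_le_addSubgroupClosure _ (h.mem_cone i)
  rw [← Submodule.span_int_eq_addSubgroupClosure] at this
  exact this

end Refines

/-! ### Elementary subtractions in a family with a distinguished member. -/

section Cons

variable {m : ℕ} {c c' : ℝ} {e f : Fin m → ℝ}

theorem cone_le_cone_cons (c : ℝ) (f : Fin m → ℝ) : AddSubmonoid.closure (Set.range f) ≤
    AddSubmonoid.closure (Set.range (Fin.cons c f : Fin (m + 1) → ℝ)) :=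
  AddSubmonoid.closure_mono (by rw [Fin.range_cons]; exact Set.subset_insert _ _)

theorem group_le_group_cons (c : ℝ) (f : Fin m → ℝ) : AddSubgroup.closure (Set.range f) ≤
    AddSubgroup.closure (Set.range (Fin.cons c f : Fin (m + 1) → ℝ)) :=
  AddSubgroup.closure_mono (by rw [Fin.range_cons]; exact Set.subset_insert _ _)

theorem mem_cone_cons (c : ℝ) (f : Fin m → ℝ) :
    c ∈ AddSubmonoid.closure (Set.range (Fin.cons c f : Fin (m + 1) → ℝ)) :=
  self_mem_cone (Fin.cons c f : Fin (m + 1) → ℝ) 0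

theorem mem_group_cons (c : ℝ) (f : Fin m → ℝ) :
    c ∈ AddSubgroup.closure (Set.range (Fin.cons c f : Fin (m + 1) → ℝ)) :=
  AddSubmonoid.closure_le_addSubgroupClosure _ (mem_cone_cons c f)

theorem Refines.cons (h : Refines e f) (hc : 0 < c) :
    Refines (Fin.cons c e : Fin (m + 1) → ℝ) (Fin.cons c f : Fin (m + 1) → ℝ) where
  pos := Fin.cases hc h.pos
  mem := Fin.cases (mem_group_cons c e) fun i => group_le_group_cons c e (h.mem i)
  mem_cone := Fin.cases (mem_cone_cons c f) fun i => cone_le_cone_cons c f (h.mem_cone i)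

theorem refines_cons_sub {h : ℝ} (hf : ∀ i, 0 < f i)
    (hh : h ∈ AddSubmonoid.closure (Set.range f)) (hc : h < c) :
    Refines (Fin.cons c f : Fin (m + 1) → ℝ) (Fin.cons (c - h) f : Fin (m + 1) → ℝ) where
  pos := Fin.cases (sub_pos.mpr hc) hf
  mem := Fin.cases (AddSubgroup.sub_mem _ (mem_group_cons c f)
    (group_le_group_cons c f (AddSubmonoid.closure_le_addSubgroupClosure _ hh)))
    fun i => AddSubgroup.subset_closure ⟨i.succ, rfl⟩
  mem_cone := Fin.cases (by
      have := add_mem (mem_cone_cons (c - h) f) (cone_le_cone_cons (c - h) f hh)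
      simpa using this)
    fun i => cone_le_cone_cons _ f (self_mem_cone f i)

theorem refines_update (hf : ∀ i, 0 < f i) (hc0 : 0 < c) {i : Fin m} (hc : c < f i) :
    Refines (Fin.cons c f : Fin (m + 1) → ℝ)
      (Fin.cons c (Function.update f i (f i - c)) : Fin (m + 1) → ℝ) where
  pos := Fin.cases hc0 fun j => by
    rw [Fin.cons_succ]
    by_cases h : j = i
    · subst h
      simpa using hc
    · rw [Function.update_of_ne h]
      exact hf j
  mem := Fin.cases (mem_group_cons c f) fun j => by
    rw [Fin.cons_succ]
    by_cases h : j = i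
    · subst h
      rw [Function.update_self]
      exact AddSubgroup.sub_mem _ (AddSubgroup.subset_closure ⟨j.succ, rfl⟩) (mem_group_cons c f)
    · rw [Function.update_of_ne h]
      exact AddSubgroup.subset_closure ⟨j.succ, rfl⟩
  mem_cone := Fin.cases (mem_cone_cons c _) fun j => by
    rw [Fin.cons_succ]
    have hj := cone_le_cone_cons c _ (self_mem_cone (Function.update f i (f i - c)) j)
    by_cases h : j = i
    · subst h
      rw [Function.update_self] at hj
      have := add_mem hj (mem_cone_cons c _)
      simpa using this
    · rwa [Function.update_of_ne h] at hj

/-- If `c` is smaller than a sum of members of `f`, the difference becomes a sum after a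
refinement. -/
theorem exists_refines_sum_sub (l : List ℝ) :
    ∀ (c : ℝ) (f : Fin m → ℝ), LinearIndependent ℤ (Fin.cons c f : Fin (m + 1) → ℝ) →
      (∀ i, 0 < f i) → 0 < c → (∀ x ∈ l, x ∈ Set.range f) → c < l.sum →
      ∃ g, Refines (Fin.cons c f : Fin (m + 1) → ℝ) g ∧
        l.sum - c ∈ AddSubmonoid.closure (Set.range g) := by
  induction l with
  | nil =>
    intro c f _ _ hc _ h
    simp at h
    linarith
  | cons x l ih =>
    intro c f hind hf hc hl hsum
    rw [List.sum_cons] at hsum ⊢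
    obtain ⟨i, rfl⟩ := hl x (by simp)
    -- Independence excludes a tie, so one of `c` and `f i` can always be subtracted from the other
    -- with a positive result.
    have hne : c ≠ f i := fun h => absurd
      (hind.injective (a₁ := 0) (a₂ := i.succ) (by simpa using h)) (Fin.succ_ne_zero i).symm
    have hl' : ∀ x ∈ l, x ∈ Set.range f := fun x hx => hl x (by simp [hx])
    rcases lt_or_gt_of_ne hne with hlt | hgt
    · have hr := refines_update hf hc hlt
      refine ⟨_, hr, ?_⟩
      have h1 : l.sum ∈ AddSubmonoid.closure (Set.range f) :=
        AddSubmonoid.list_sum_mem _ fun x hx => AddSubmonoid.subset_closure (hl' x hx)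
      have h2 := self_mem_cone (Fin.cons c (Function.update f i (f i - c)) : Fin (m + 1) → ℝ) i.succ
      rw [Fin.cons_succ, Function.update_self] at h2
      have := add_mem h2 (hr.cone_le (cone_le_cone_cons c f h1))
      convert this using 1
      ring
    · have hr := refines_cons_sub hf (self_mem_cone f i) hgt
      obtain ⟨g, hg, hg'⟩ := ih (c - f i) f (hr.linearIndependent hind) hf (sub_pos.mpr hgt) hl'
        (by linarith)
      refine ⟨g, hr.trans hg, ?_⟩
      convert hg' using 1
      ring

end Cons

/-- Subtractive Euclidean algorithm: subtracting the smaller generator from the larger one adds up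
the two coefficients. Unless the new coefficients are both non-negative, they still have opposite
signs, and then the sum of absolute values has dropped. -/
theorem exists_refines_two (N : ℕ) : ∀ (a b : ℝ) (n k : ℤ), LinearIndependent ℤ ![a, b] → 0 < a →
    0 < b → n.natAbs + k.natAbs ≤ N → 0 < n * a + k * b →
    ∃ f, Refines ![a, b] f ∧ n * a + k * b ∈ AddSubmonoid.closure (Set.range f) := by
  induction N with
  | zero =>
    intro a b n k _ _ _ h hpos
    have hn : n = 0 := by omega
    have hk : k = 0 := by omega
    simp [hn, hk] at hpos
  | succ N ih =>
    intro a b n k hind ha hb hN hpos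
    have hab : ∀ i, 0 < ![a, b] i := Fin.forall_fin_two.mpr ⟨ha, hb⟩
    have hmem : ∀ {x y : ℝ} {n k : ℤ}, 0 ≤ n → 0 ≤ k →
        n * x + k * y ∈ AddSubmonoid.closure (Set.range ![x, y]) := by
      intro x y n k hn hk
      lift n to ℕ using hn
      lift k to ℕ using hk
      have h1 := (AddSubmonoid.closure (Set.range ![x, y])).nsmul_mem (self_mem_cone ![x, y] 0) n
      have h2 := (AddSubmonoid.closure (Set.range ![x, y])).nsmul_mem (self_mem_cone ![x, y] 1) k
      have := add_mem h1 h2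
      simpa [nsmul_eq_mul] using this
    have hne : a ≠ b := fun h => absurd
      (hind.injective (a₁ := 0) (a₂ := 1) (by simpa using h)) (by simp)
    have hg0 : ∀ x y : ℝ, x ∈ AddSubgroup.closure (Set.range ![x, y]) := fun x y =>
      AddSubgroup.subset_closure ⟨0, rfl⟩
    have hg1 : ∀ x y : ℝ, y ∈ AddSubgroup.closure (Set.range ![x, y]) := fun x y =>
      AddSubgroup.subset_closure ⟨1, rfl⟩
    by_cases hnn : 0 ≤ n ∧ 0 ≤ k
    · exact ⟨_, Refines.refl hab, hmem hnn.1 hnn.2⟩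
    have hpos' : 0 < n ∨ 0 < k := by
      by_contra! hc
      have h1 : (n : ℝ) ≤ 0 := by exact_mod_cast hc.1
      have h2 : (k : ℝ) ≤ 0 := by exact_mod_cast hc.2
      nlinarith [mul_nonneg (neg_nonneg.mpr h1) ha.le, mul_nonneg (neg_nonneg.mpr h2) hb.le]
    rcases lt_or_gt_of_ne hne with hlt | hgt
    · have hr : Refines ![a, b] ![a, b - a] :=
        ⟨Fin.forall_fin_two.mpr ⟨ha, sub_pos.mpr hlt⟩,
          Fin.forall_fin_two.mpr ⟨hg0 a b, AddSubgroup.sub_mem _ (hg1 a b) (hg0 a b)⟩,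
          Fin.forall_fin_two.mpr ⟨self_mem_cone ![a, b - a] 0, by
            have := add_mem (self_mem_cone ![a, b - a] 0) (self_mem_cone ![a, b - a] 1)
            simpa using this⟩⟩
      have heq : n * a + k * b = ((n + k : ℤ) : ℝ) * a + k * (b - a) := by
        push_cast
        ring
      rw [heq] at hpos ⊢
      by_cases hs : 0 ≤ n + k ∧ 0 ≤ k
      · exact ⟨_, hr, hmem hs.1 hs.2⟩
      have hs' : 0 < n + k ∨ 0 < k := by
        by_contra! hc
        have h1 : ((n + k : ℤ) : ℝ) ≤ 0 := by exact_mod_cast hc.1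
        have h2 : (k : ℝ) ≤ 0 := by exact_mod_cast hc.2
        nlinarith [mul_nonneg (neg_nonneg.mpr h1) ha.le,
          mul_nonneg (neg_nonneg.mpr h2) (sub_pos.mpr hlt).le]
      obtain ⟨f, hf, hf'⟩ := ih a (b - a) (n + k) k (hr.linearIndependent hind) ha
        (sub_pos.mpr hlt) (by omega) hpos
      exact ⟨f, hr.trans hf, hf'⟩
    · have hr : Refines ![a, b] ![a - b, b] :=
        ⟨Fin.forall_fin_two.mpr ⟨sub_pos.mpr hgt, hb⟩,
          Fin.forall_fin_two.mpr ⟨AddSubgroup.sub_mem _ (hg0 a b) (hg1 a b), hg1 a b⟩,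
          Fin.forall_fin_two.mpr ⟨by
            have := add_mem (self_mem_cone ![a - b, b] 0) (self_mem_cone ![a - b, b] 1)
            simpa using this, self_mem_cone ![a - b, b] 1⟩⟩
      have heq : n * a + k * b = (n : ℝ) * (a - b) + ((n + k : ℤ) : ℝ) * b := by
        push_cast
        ring
      rw [heq] at hpos ⊢
      by_cases hs : 0 ≤ n ∧ 0 ≤ n + k
      · exact ⟨_, hr, hmem hs.1 hs.2⟩
      have hs' : 0 < n ∨ 0 < n + k := by
        by_contra! hc
        have h1 : ((n + k : ℤ) : ℝ) ≤ 0 := by exact_mod_cast hc.2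
        have h2 : (n : ℝ) ≤ 0 := by exact_mod_cast hc.1
        nlinarith [mul_nonneg (neg_nonneg.mpr h1) hb.le,
          mul_nonneg (neg_nonneg.mpr h2) (sub_pos.mpr hgt).le]
      obtain ⟨f, hf, hf'⟩ := ih (a - b) b n (n + k) (hr.linearIndependent hind)
        (sub_pos.mpr hgt) hb (by omega) hpos
      exact ⟨f, hr.trans hf, hf'⟩

/-- A subgroup of `ℝ` is dense or cyclic, and two independent elements do not fit into a cyclic
group. -/
theorem dense_closure_of_linearIndependent {n : ℕ} {e : Fin (n + 2) → ℝ}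
    (he : LinearIndependent ℤ e) : Dense (AddSubgroup.closure (Set.range e) : Set ℝ) := by
  rcases AddSubgroup.dense_or_cyclic (AddSubgroup.closure (Set.range e)) with h | ⟨a, ha⟩
  · exact h
  · exfalso
    have hm : ∀ i, e i ∈ AddSubgroup.closure {a} := fun i =>
      ha ▸ AddSubgroup.subset_closure ⟨i, rfl⟩
    obtain ⟨k, hk⟩ := AddSubgroup.mem_closure_singleton.mp (hm 0)
    obtain ⟨l, hl⟩ := AddSubgroup.mem_closure_singleton.mp (hm 1)
    have hpair : LinearIndependent ℤ ![e 0, e 1] := by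
      have := he.comp ![0, 1] (by
        intro i j
        fin_cases i <;> fin_cases j <;> simp)
      convert this using 1
      funext i
      fin_cases i <;> rfl
    rw [LinearIndependent.pair_iff] at hpair
    have h1 := hpair l (-k) (by rw [← hk, ← hl]; simp only [zsmul_eq_mul]; push_cast; ring)
    have h2 : e 0 = 0 := by
      rw [← hk, neg_eq_zero.mp h1.2, zero_smul]
    exact he.ne_zero 0 h2

theorem exists_refines_mem (n : ℕ) : ∀ (e : Fin (n + 2) → ℝ) (p : ℝ), LinearIndependent ℤ e →
    (∀ i, 0 < e i) → p ∈ AddSubgroup.closure (Set.range e) → 0 < p →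
    ∃ f, Refines e f ∧ p ∈ AddSubmonoid.closure (Set.range f) := by
  induction n with
  | zero =>
    intro e p hind he hp hpos
    have hee : e = ![e 0, e 1] := by
      funext i
      fin_cases i <;> rfl
    have hr : Set.range e = {e 0} ∪ {e 1} := by
      ext x
      simp [Fin.exists_fin_two, eq_comm, or_comm]
    rw [hr, AddSubgroup.closure_union, AddSubgroup.mem_sup] at hp
    obtain ⟨y, hy, z, hz, rfl⟩ := hp
    obtain ⟨k, rfl⟩ := AddSubgroup.mem_closure_singleton.mp hy
    obtain ⟨l, rfl⟩ := AddSubgroup.mem_closure_singleton.mp hz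
    rw [zsmul_eq_mul, zsmul_eq_mul] at hpos ⊢
    have := exists_refines_two _ (e 0) (e 1) k l (hee ▸ hind) (he 0) (he 1) le_rfl hpos
    rwa [← hee] at this
  | succ n ih =>
    intro e p hind he hp hpos
    obtain ⟨c, e', rfl⟩ : ∃ c, ∃ e' : Fin (n + 2) → ℝ, e = (Fin.cons c e' : Fin (n + 3) → ℝ) :=
      ⟨e 0, Fin.tail e, (Fin.cons_self_tail e).symm⟩
    have hc : 0 < c := he 0
    have he' : ∀ i, 0 < e' i := fun i => he i.succ
    have hind' : LinearIndependent ℤ e' := by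
      have := hind.comp Fin.succ (Fin.succ_injective _)
      exact this
    have hdense := dense_closure_of_linearIndependent hind'
    have ih₂ : ∀ x y : ℝ, x ∈ AddSubgroup.closure (Set.range e') →
        y ∈ AddSubgroup.closure (Set.range e') → 0 < x → 0 < y → ∃ f, Refines e' f ∧
          x ∈ AddSubmonoid.closure (Set.range f) ∧ y ∈ AddSubmonoid.closure (Set.range f) := by
      intro x y hx hy hx0 hy0
      obtain ⟨f, hf, hxf⟩ := ih e' x hind' he' hx hx0
      obtain ⟨g, hg, hyg⟩ := ih f y (hf.linearIndependent hind') hf.pos (hf.group_le hy) hy0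
      exact ⟨g, hf.trans hg, hg.cone_le hxf, hyg⟩
    rw [Fin.range_cons, Set.insert_eq, AddSubgroup.closure_union, AddSubgroup.mem_sup] at hp
    obtain ⟨y, hy, h, hh, rfl⟩ := hp
    obtain ⟨k, rfl⟩ := AddSubgroup.mem_closure_singleton.mp hy
    rw [zsmul_eq_mul] at hpos ⊢
    rcases lt_trichotomy k 0 with hk | rfl | hk
    · obtain ⟨N, hN⟩ : ∃ N : ℕ, k = -(N : ℤ) := ⟨k.natAbs, by omega⟩
      have hN0 : (0 : ℝ) < N := by
        have : 0 < N := by omega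
        exact_mod_cast this
      subst hN
      push_cast at hpos ⊢
      -- With `p = h - N c`, density gives `h₄` with `c < h₄ < h / N`, so that `p = (h - N h₄) + N
      -- (h₄ - c)` with positive summands. The first and `h₄` are handled by induction, then `h₄ -
      -- c` by `exists_refines_sum_sub`.
      obtain ⟨h₄, hmem, hlt, hgt⟩ := hdense.exists_between
        (show c < h / N by rw [lt_div_iff₀ hN0]; linarith)
      rw [lt_div_iff₀ hN0] at hgt
      have hmem' : h - N * h₄ ∈ AddSubgroup.closure (Set.range e') := by
        rw [← nsmul_eq_mul]
        exact AddSubgroup.sub_mem _ hh (AddSubgroup.nsmul_mem _ hmem N)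
      obtain ⟨f, hf, h1, h2⟩ := ih₂ h₄ (h - N * h₄) hmem hmem' (hc.trans hlt) (by linarith)
      have hr := hf.cons hc
      obtain ⟨l, hl, rfl⟩ := AddSubmonoid.exists_list_of_mem_closure h1
      obtain ⟨g, hg, hg'⟩ := exists_refines_sum_sub l c f (hr.linearIndependent hind) hf.pos hc hl
        hlt
      refine ⟨g, hr.trans hg, ?_⟩
      have := add_mem (hg.cone_le (cone_le_cone_cons c f h2)) (AddSubmonoid.nsmul_mem _ hg' N)
      rw [nsmul_eq_mul] at this
      convert this using 1
      ring
    · simp only [Int.cast_zero, zero_mul, zero_add] at hpos ⊢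
      obtain ⟨f, hf, hf'⟩ := ih e' h hind' he' hh hpos
      exact ⟨_, hf.cons hc, cone_le_cone_cons c f hf'⟩
    · obtain ⟨N, hN⟩ : ∃ N : ℕ, k = (N : ℤ) := ⟨k.natAbs, by omega⟩
      have hN0 : (0 : ℝ) < N := by
        have : 0 < N := by omega
        exact_mod_cast this
      subst hN
      push_cast at hpos ⊢
      -- Here `p = N (c - h₀) + (h + N h₀)`, and replacing the generator `c` by `c - h₀` suffices.
      obtain ⟨h₀, hmem, hlt, hgt⟩ := hdense.exists_between
        (show max 0 (-h / N) < c from max_lt hc (by rw [div_lt_iff₀ hN0]; linarith))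
      obtain ⟨h00, hlt⟩ := max_lt_iff.mp hlt
      rw [div_lt_iff₀ hN0] at hlt
      have hmem' : h + N * h₀ ∈ AddSubgroup.closure (Set.range e') := by
        rw [← nsmul_eq_mul]
        exact AddSubgroup.add_mem _ hh (AddSubgroup.nsmul_mem _ hmem N)
      obtain ⟨f, hf, h1, h2⟩ := ih₂ h₀ (h + N * h₀) hmem hmem' h00 (by linarith)
      refine ⟨_, (hf.cons hc).trans (refines_cons_sub hf.pos h1 hgt), ?_⟩
      have := add_mem (AddSubmonoid.nsmul_mem _ (mem_cone_cons (c - h₀) f) N)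
        (cone_le_cone_cons (c - h₀) f h2)
      rw [nsmul_eq_mul] at this
      convert this using 1
      ring

theorem exists_refines_forall_mem {n : ℕ} {e : Fin (n + 2) → ℝ} (hind : LinearIndependent ℤ e)
    (he : ∀ i, 0 < e i) (P : Finset ℝ)
    (hP : ∀ p ∈ P, p ∈ AddSubgroup.closure (Set.range e) ∧ 0 < p) :
    ∃ f, Refines e f ∧ ∀ p ∈ P, p ∈ AddSubmonoid.closure (Set.range f) := by
  induction P using Finset.induction_on with
  | empty => exact ⟨e, Refines.refl he, by simp⟩
  | insert p P _ ih =>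
    obtain ⟨f, hf, hfP⟩ := ih fun q hq => hP q (Finset.mem_insert_of_mem hq)
    obtain ⟨hp, hp0⟩ := hP p (Finset.mem_insert_self p P)
    obtain ⟨g, hg, hgp⟩ := exists_refines_mem n f p (hf.linearIndependent hind) hf.pos
      (hf.group_le hp) hp0
    refine ⟨g, hf.trans hg, fun q hq => ?_⟩
    rcases Finset.mem_insert.mp hq with rfl | hq
    exacts [hgp, hg.cone_le (hfP q hq)]

theorem mem_cone_iff {ι : Type*} [Fintype ι] {f : ι → ℝ} {x : ℝ} :
    x ∈ AddSubmonoid.closure (Set.range f) ↔ ∃ c : ι → ℕ, x = ∑ i, c i * f i := by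
  classical
  constructor
  · intro hx
    induction hx using AddSubmonoid.closure_induction with
    | mem x hx =>
      obtain ⟨i, rfl⟩ := hx
      exact ⟨Pi.single i 1, by simp [Pi.single_apply]⟩
    | zero => exact ⟨0, by simp⟩
    | add x y _ _ hx hy =>
      obtain ⟨c, rfl⟩ := hx
      obtain ⟨d, rfl⟩ := hy
      exact ⟨c + d, by simp [add_mul, Finset.sum_add_distrib]⟩
  · rintro ⟨c, rfl⟩
    refine AddSubmonoid.sum_mem _ fun i _ => ?_
    rw [← nsmul_eq_mul]
    exact AddSubmonoid.nsmul_mem _ (self_mem_cone f i) _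

/-- An order unit has positive coordinates. -/
theorem Refines.one_le_coeff {ι : Type*} [Fintype ι] {e f : ι → ℝ} (h : Refines e f)
    (hf : LinearIndependent ℤ f) {N : ℕ} {c : ι → ℕ}
    (hN : ∀ i, N * (∑ j, c j * f j) - e i ∈ AddSubmonoid.closure (Set.range f)) (k : ι) :
    1 ≤ c k := by
  by_contra hc
  have hc0 : c k = 0 := by omega
  -- If the `k`-th coordinate of the order unit is `0`, then so is that of each `e i`, since `e i`
  -- and `N * unit - e i` both have non-negative coordinates. But `f k` lies in the group generated
  -- by `e`.
  have he : ∀ i, e i ∈ Submodule.span ℤ (f '' {k}ᶜ) := by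
    intro i
    obtain ⟨b, hb⟩ := mem_cone_iff.mp (h.mem_cone i)
    obtain ⟨d, hd⟩ := mem_cone_iff.mp (hN i)
    have hzero : ∑ j, ((N * c j : ℤ) - b j - d j) • f j = 0 := by
      have : ∑ j, ((N * c j : ℤ) - b j - d j) • f j =
          N * (∑ j, c j * f j) - (∑ j, b j * f j) - ∑ j, d j * f j := by
        rw [Finset.mul_sum, ← Finset.sum_sub_distrib, ← Finset.sum_sub_distrib]
        refine Finset.sum_congr rfl fun j _ => ?_
        rw [zsmul_eq_mul]
        push_cast
        ring
      rw [this, ← hd, ← hb]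
      ring
    have hk := Fintype.linearIndependent_iff.mp hf _ hzero k
    rw [hc0] at hk
    have hbk : b k = 0 := by
      push_cast at hk
      omega
    rw [hb]
    refine Submodule.sum_mem _ fun j _ => ?_
    by_cases hj : j = k
    · rw [hj, hbk]
      simp
    · rw [← nsmul_eq_mul]
      exact Submodule.smul_of_tower_mem _ _ (Submodule.subset_span ⟨j, hj, rfl⟩)
  have hle : AddSubgroup.closure (Set.range e) ≤
      (Submodule.span ℤ (f '' {k}ᶜ)).toAddSubgroup := by
    rw [AddSubgroup.closure_le]
    rintro _ ⟨i, rfl⟩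
    exact he i
  exact hf.notMem_span_image (s := {k}ᶜ) (x := k) (by simp) (hle (h.mem k))

theorem exists_basis_of_finset {Γ : AddSubgroup ℝ} (hone : (1 : ℝ) ∈ Γ)
    (hirr : ¬ (Γ : Set ℝ) ⊆ Set.range ((↑) : ℚ → ℝ)) (P : Finset ℝ) (hP : ∀ p ∈ P, p ∈ Γ) :
    ∃ (n : ℕ) (e : Fin (n + 2) → ℝ), LinearIndependent ℤ e ∧ (∀ i, 0 < e i) ∧ (∀ i, e i ∈ Γ) ∧
      ∀ p ∈ P, p ∈ AddSubgroup.closure (Set.range e) := by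
  classical
  obtain ⟨α, hα, hαirr⟩ := Set.not_subset.mp hirr
  set V := Submodule.span ℤ (insert 1 (insert α (P : Set ℝ))) with hV
  have hfin : Module.Finite ℤ V :=
    Module.Finite.span_of_finite ℤ ((P.finite_toSet.insert α).insert 1)
  have h1V : (1 : ℝ) ∈ V := Submodule.subset_span (by simp)
  have hαV : α ∈ V := Submodule.subset_span (by simp)
  have hVΓ : ∀ x ∈ V, x ∈ Γ := by
    have : V.toAddSubgroup ≤ Γ := by
      rw [hV, Submodule.span_int_eq_addSubgroupClosure, AddSubgroup.closure_le]
      rintro x (rfl | rfl | hx)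
      exacts [hone, hα, hP x hx]
    exact fun x hx => this hx
  have hrank : 2 ≤ Module.finrank ℤ V := by
    have hli : LinearIndependent ℤ ![(⟨1, h1V⟩ : V), ⟨α, hαV⟩] := by
      rw [LinearIndependent.pair_iff]
      intro s t hst
      have h : (s : ℝ) + t * α = 0 := by
        have := congrArg Subtype.val hst
        simpa using this
      have ht : t = 0 := by
        by_contra ht
        have ht' : (t : ℝ) ≠ 0 := by exact_mod_cast ht
        refine hαirr ⟨-s / t, ?_⟩
        push_cast
        field_simp
        linarith
      subst ht
      simp at h
      exact ⟨h, rfl⟩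
    simpa using hli.fintype_card_le_finrank
  obtain ⟨n, hn⟩ : ∃ n, Module.finrank ℤ V = n + 2 := ⟨_, (Nat.sub_add_cancel hrank).symm⟩
  let b : Module.Basis (Fin (n + 2)) ℤ V := (Module.finBasis ℤ V).reindex (finCongr hn)
  have hb : LinearIndependent ℤ fun i => (b i : ℝ) :=
    b.linearIndependent.map' V.subtype (Submodule.ker_subtype V)
  have hbne : ∀ i, (b i : ℝ) ≠ 0 := fun i => hb.ne_zero i
  -- Sign changes make the members of a `ℤ`-basis positive without affecting independence or the
  -- group.
  let w : Fin (n + 2) → ℤˣ := fun i => if 0 < (b i : ℝ) then 1 else -1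
  have hw : ∀ i, w i • (b i : ℝ) = |(b i : ℝ)| := by
    intro i
    simp only [w]
    split_ifs with h
    · rw [one_smul, abs_of_pos h]
    · rw [abs_of_nonpos (not_lt.mp h), Units.smul_def]
      simp
  refine ⟨n, fun i => |(b i : ℝ)|, ?_, fun i => abs_pos.mpr (hbne i), fun i => ?_, fun p hp => ?_⟩
  · convert hb.units_smul w using 1
    funext i
    exact (hw i).symm
  · have := hVΓ _ (b i).2
    rcases abs_choice (b i : ℝ) with h | h <;> simp only [h]
    exacts [this, Γ.neg_mem this]
  · have hpV : p ∈ V := Submodule.subset_span (by simp [hp])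
    have hrepr := congrArg Subtype.val (b.sum_repr ⟨p, hpV⟩)
    simp only [AddSubmonoidClass.coe_finsetSum, Submodule.coe_smul] at hrepr
    rw [← hrepr]
    refine AddSubgroup.sum_mem _ fun i _ => AddSubgroup.zsmul_mem _ ?_ _
    have hi : |(b i : ℝ)| ∈ AddSubgroup.closure (Set.range fun i => |(b i : ℝ)|) :=
      AddSubgroup.subset_closure ⟨i, rfl⟩
    rcases abs_choice (b i : ℝ) with h | h
    · rwa [h] at hi
    · rw [h] at hi
      exact neg_mem_iff.mp hi

/-- Finitely many positive elements of a non-cyclic group of real numbers have integral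
coordinates at least `2` with respect to some linearly independent family of positive elements. -/
theorem exists_strictAnti_basis {Γ : AddSubgroup ℝ} (hone : (1 : ℝ) ∈ Γ)
    (hirr : ¬ (Γ : Set ℝ) ⊆ Set.range ((↑) : ℚ → ℝ)) (P : Finset ℝ)
    (hP : ∀ p ∈ P, p ∈ Γ ∧ 0 < p) :
    ∃ (n : ℕ) (f : Fin (n + 2) → ℝ), StrictAnti f ∧ LinearIndependent ℤ f ∧ (∀ i, f i ∈ Γ) ∧
      (∀ i, 0 < f i) ∧ ∀ p ∈ P, p - 2 * ∑ i, f i ∈ AddSubmonoid.closure (Set.range f) := by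
  classical
  obtain ⟨n, e, hind, he, heΓ, hPe⟩ := exists_basis_of_finset hone hirr P fun p hp => (hP p hp).1
  have hdense := dense_closure_of_linearIndependent hind
  obtain ⟨β, hβ, hβP⟩ : ∃ β : ℝ, 0 < β ∧ ∀ p ∈ P, β ≤ p := by
    have hne : (insert 1 P).Nonempty := Finset.insert_nonempty _ _
    refine ⟨(insert 1 P).min' hne, ?_, fun p hp => Finset.min'_le _ _ (by simp [hp])⟩
    rcases Finset.mem_insert.mp ((insert 1 P).min'_mem hne) with h | h
    · rw [h]
      exact one_pos
    · exact (hP _ h).2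
  -- With `η < β / 2` every `p - 2η` is positive. Once `η` has all coordinates `≥ 1`, the
  -- decomposition `p - 2 ∑ f = (p - 2η) + 2 (η - ∑ f)` has both summands in the cone.
  obtain ⟨η, hη, hη0, hηβ⟩ := hdense.exists_between (half_pos hβ)
  obtain ⟨N, hN⟩ : ∃ N : ℕ, ∀ i, e i < N * η := by
    obtain ⟨N, hN⟩ := exists_nat_gt ((∑ i, e i) / η)
    refine ⟨N, fun i => ?_⟩
    rw [div_lt_iff₀ hη0] at hN
    exact (Finset.single_le_sum (fun j _ => (he j).le) (Finset.mem_univ i)).trans_lt hN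
  have hmul : ∀ N : ℕ, N * η ∈ AddSubgroup.closure (Set.range e) := fun N => by
    rw [← nsmul_eq_mul]
    exact AddSubgroup.nsmul_mem _ hη N
  obtain ⟨f, hf, hfP⟩ := exists_refines_forall_mem hind he
    (insert η (P.image (fun p => p - (2 : ℕ) * η) ∪ Finset.univ.image fun i => N * η - e i)) (by
      intro q hq
      simp only [Finset.mem_insert, Finset.mem_union, Finset.mem_image, Finset.mem_univ,
        true_and] at hq
      rcases hq with rfl | ⟨p, hp, rfl⟩ | ⟨i, rfl⟩
      · exact ⟨hη, hη0⟩
      · refine ⟨AddSubgroup.sub_mem _ (hPe p hp) (hmul 2), ?_⟩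
        have := hβP p hp
        push_cast
        linarith
      · exact ⟨AddSubgroup.sub_mem _ (hmul N) (AddSubgroup.subset_closure ⟨i, rfl⟩),
          sub_pos.mpr (hN i)⟩)
  have hfind := hf.linearIndependent hind
  have hsum : η - ∑ i, f i ∈ AddSubmonoid.closure (Set.range f) := by
    obtain ⟨c, hc⟩ := mem_cone_iff.mp (hfP η (by simp))
    have hc1 := hf.one_le_coeff hfind (N := N) (c := c) fun i => by
      rw [← hc]
      exact hfP _ (by simp)
    refine mem_cone_iff.mpr ⟨fun i => c i - 1, ?_⟩
    rw [hc, ← Finset.sum_sub_distrib]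
    refine Finset.sum_congr rfl fun i _ => ?_
    rw [Nat.cast_sub (hc1 i)]
    push_cast
    ring
  let σ : Equiv.Perm (Fin (n + 2)) := Tuple.sort fun i => -f i
  have hanti : StrictAnti (f ∘ σ) := by
    refine Antitone.strictAnti_of_injective (fun i j hij => ?_)
      (hfind.injective.comp σ.injective)
    have := Tuple.monotone_sort (fun i => -f i) hij
    simpa using this
  have hrange : Set.range (f ∘ σ) = Set.range f := σ.surjective.range_comp f
  have hle : AddSubgroup.closure (Set.range e) ≤ Γ := by
    rw [AddSubgroup.closure_le]
    rintro _ ⟨i, rfl⟩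
    exact heΓ i
  refine ⟨n, f ∘ σ, hanti, hfind.comp σ σ.injective, fun i => hle (hf.mem _), fun i => hf.pos _,
    fun p hp => ?_⟩
  have h1 : ∑ i, (f ∘ σ) i = ∑ i, f i := Equiv.sum_comp σ f
  rw [hrange, h1]
  have h2 := hfP (p - (2 : ℕ) * η) (by
    simp only [Finset.mem_insert, Finset.mem_union, Finset.mem_image]
    exact Or.inr (Or.inl ⟨p, hp, rfl⟩))
  have := add_mem h2 (add_mem hsum hsum)
  convert this using 1
  push_cast
  ring

/-! ## Finite stages of the construction -/

/-- The values of `Q` and of the weights up to the index `u`; the balance condition holds at the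
indices smaller than `l`. -/
structure Stage where
  l : ℕ
  u : ℕ
  Q : ℕ → ℕ
  A : ℕ → ℝ

namespace Stage

/-- The part of the weight that is not yet distributed at the index `j`. -/
def defect (s : Stage) (j : ℕ) : ℝ :=
  s.A j - s.A (j + 1) - ∑ i ∈ Finset.Ioc 0 s.u, if s.Q i = j then s.A i else 0

structure Valid (Γ : AddSubgroup ℝ) (s : Stage) : Prop where
  lt : s.l < s.u
  Q_lt : ∀ i, 1 ≤ i → i ≤ s.u → s.Q i < s.u
  mem : ∀ i ≤ s.u, s.A i ∈ Γ
  pos : ∀ i ≤ s.u, 0 < s.A i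
  defect_nonneg : ∀ j, s.l ≤ j → j < s.u → 0 ≤ s.defect j

/-- The lower ends `l` of consecutive stages become the sequence `q` of intervals, so `t.u` is the
first index of a later interval and must be sent to `s.u`, the start of the preceding one. The gap
of `2` makes this compatible with `Q k ≤ k - 2`. -/
structure Extends (s t : Stage) : Prop where
  l_eq : t.l = s.u
  u_le : s.u + 2 ≤ t.u
  Q_eq : ∀ k ≤ s.u, t.Q k = s.Q k
  A_eq : ∀ k ≤ s.u, t.A k = s.A k
  Q_mem : ∀ i, s.u < i → i < t.u → s.l ≤ t.Q i ∧ t.Q i < s.u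
  Q_last : t.Q t.u = s.u
  balance : ∀ j, s.l ≤ j → j < s.u →
    s.defect j = ∑ i ∈ Finset.Ioo s.u t.u, if t.Q i = j then t.A i else 0

theorem sum_Ioc_eq {a b : ℕ} (hab : a < b) (F : ℕ → ℝ) :
    ∑ i ∈ Finset.Ioc 0 b, F i = ∑ i ∈ Finset.Ioc 0 a, F i + ∑ i ∈ Finset.Ioo a b, F i + F b := by
  rw [← Finset.sum_Ioc_consecutive F (Nat.zero_le a) hab.le, add_assoc,
    ← Finset.Ioo_insert_right hab, Finset.sum_insert (by simp), add_comm (F b)]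

/-- Among the indices from `1` to `t.u`, only `t.u` is sent to a place `≥ s.u`, so beyond `s.u` the
defect is a plain difference of consecutive weights. -/
theorem defect_eq_of_Q {s t : Stage} (hsQ : ∀ i, 1 ≤ i → i ≤ s.u → s.Q i < s.u)
    (hlt : s.u < t.u) (hQ : ∀ k ≤ s.u, t.Q k = s.Q k) (hA : ∀ k ≤ s.u, t.A k = s.A k)
    (hmem : ∀ i, s.u < i → i < t.u → t.Q i < s.u) (hlast : t.Q t.u = s.u) {j : ℕ}
    (hj : s.u ≤ j) :
    t.defect j = (if j = s.u then s.A s.u - t.A t.u else t.A j) - t.A (j + 1) := by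
  rw [defect, sum_Ioc_eq hlt, Finset.sum_eq_zero, Finset.sum_eq_zero, hlast]
  · by_cases h : j = s.u
    · rw [if_pos h, if_pos h.symm, h, hA _ le_rfl]
      ring
    · rw [if_neg h, if_neg (Ne.symm h)]
      ring
  · intro i hi
    rw [Finset.mem_Ioo] at hi
    have := hmem i hi.1 hi.2
    exact if_neg (by omega)
  · intro i hi
    rw [Finset.mem_Ioc] at hi
    have := hsQ i (by omega) hi.2
    rw [hQ i hi.2]
    exact if_neg (by omega)

theorem Extends.defect_eq {Γ : AddSubgroup ℝ} {s t : Stage} (h : Extends s t) (hs : Valid Γ s)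
    {j : ℕ} (hj : s.u ≤ j) :
    t.defect j = (if j = s.u then s.A s.u - t.A t.u else t.A j) - t.A (j + 1) :=
  defect_eq_of_Q hs.Q_lt (by have := h.u_le; omega) h.Q_eq h.A_eq
    (fun i h1 h2 => (h.Q_mem i h1 h2).2) h.Q_last hj

/-- A stage is extended by distributing the defects over a list of weights and labels. -/
theorem Valid.exists_extends_of_multiset {Γ : AddSubgroup ℝ} {s : Stage} (hs : Valid Γ s)
    {y : ℝ} (hyΓ : y ∈ Γ) (hy : 0 < y) {M : Multiset (ℝ × ℕ)} (hM0 : M ≠ 0)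
    (hM : ∀ p ∈ M, p.1 ∈ Γ ∧ y ≤ p.1 ∧ p.1 ≤ s.A s.u - y ∧ s.l ≤ p.2 ∧ p.2 < s.u)
    (hsum : ∀ j, s.l ≤ j → j < s.u →
      (M.map fun p => if p.2 = j then p.1 else 0).sum = s.defect j) :
    ∃ t, Valid Γ t ∧ Extends s t ∧ t.A t.u = y ∧
      (∀ i j, s.u < i → i ≤ j → j < t.u → t.A j ≤ t.A i) ∧
      (Finset.Ioo s.u t.u).val.map (fun i => (t.A i, t.Q i)) = M := by
  classical
  let r : ℝ × ℕ → ℝ × ℕ → Prop := fun p q => q.1 ≤ p.1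
  have htot : Std.Total r := ⟨fun p q => le_total _ _⟩
  have htrans : IsTrans (ℝ × ℕ) r := ⟨fun p q w h h' => le_trans h' h⟩
  obtain ⟨L, hLM, hsorted⟩ : ∃ L : List (ℝ × ℕ), (L : Multiset (ℝ × ℕ)) = M ∧ L.Pairwise r :=
    ⟨M.toList.insertionSort r,
      by rw [Multiset.coe_eq_coe.mpr (List.perm_insertionSort r M.toList), Multiset.coe_toList],
      List.pairwise_insertionSort r M.toList⟩
  have hlen : 0 < L.length := by
    rw [List.length_pos_iff]
    rintro h
    rw [h] at hLM
    exact hM0 hLM.symm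
  -- The default value `(y, s.u)` of the list supplies the weight and the label of the final index
  -- `t.u`.
  let d : ℕ → ℝ × ℕ := fun i => L.getD (i - (s.u + 1)) (y, s.u)
  let t : Stage := ⟨s.u, s.u + 1 + L.length, fun i => if i ≤ s.u then s.Q i else (d i).2,
    fun i => if i ≤ s.u then s.A i else (d i).1⟩
  have htu : t.u = s.u + 1 + L.length := rfl
  have htl : t.l = s.u := rfl
  have hQ : ∀ k ≤ s.u, t.Q k = s.Q k := fun k hk => if_pos hk
  have hA : ∀ k ≤ s.u, t.A k = s.A k := fun k hk => if_pos hk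
  have hQd : ∀ k, s.u < k → t.Q k = (d k).2 := fun k hk => if_neg (by omega)
  have hAd : ∀ k, s.u < k → t.A k = (d k).1 := fun k hk => if_neg (by omega)
  have hd : ∀ k (h : s.u < k) (h' : k < t.u), d k = L[k - (s.u + 1)]'(by omega) := fun k h h' =>
    List.getD_eq_getElem _ _ (by omega)
  have hdlast : d t.u = (y, s.u) := by
    rw [htu]
    simp only [d]
    rw [Nat.add_sub_cancel_left, List.getD_eq_default _ _ le_rfl]
  have hAlast : t.A t.u = y := by rw [hAd _ (by omega), hdlast]
  have hQlast : t.Q t.u = s.u := by rw [hQd _ (by omega), hdlast]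
  have hdM : ∀ k, s.u < k → k < t.u → d k ∈ M := fun k h h' => by
    rw [hd k h h', ← hLM]
    exact Multiset.mem_coe.mpr (List.getElem_mem _)
  have hanti : ∀ i j, s.u < i → i ≤ j → j < t.u → t.A j ≤ t.A i := by
    intro i j hi hij hj
    rcases hij.eq_or_lt with rfl | hlt
    · exact le_rfl
    rw [hAd j (by omega), hAd i hi, hd j (by omega) hj, hd i hi (by omega)]
    exact List.pairwise_iff_getElem.mp hsorted _ _ _ _ (by omega)
  have hmap : (Finset.Ioo s.u t.u).val.map (fun i => (t.A i, t.Q i)) = M := by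
    have h1 : Finset.Ioo s.u t.u = (Finset.range L.length).map (addLeftEmbedding (s.u + 1)) := by
      ext i
      simp only [Finset.mem_Ioo, Finset.mem_map, Finset.mem_range, addLeftEmbedding_apply]
      constructor
      · rintro ⟨h1, h2⟩
        exact ⟨i - (s.u + 1), by omega, by omega⟩
      · rintro ⟨a, ha, rfl⟩
        omega
    have h2 : (fun i => (t.A i, t.Q i)) ∘ addLeftEmbedding (s.u + 1) =
        fun i => L.getD i (y, s.u) := by
      funext i
      simp only [Function.comp, addLeftEmbedding_apply]
      rw [hAd _ (by omega), hQd _ (by omega)]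
      simp [d]
    rw [h1, Finset.map_val, Multiset.map_map, h2, Finset.range_val, ← hLM, ← Multiset.coe_range,
      Multiset.map_coe]
    refine congrArg _ (List.ext_getElem (by simp) fun i h1 h2 => ?_)
    simp [h2]
  have hQmem : ∀ i, s.u < i → i < t.u → s.l ≤ t.Q i ∧ t.Q i < s.u := fun i h1 h2 => by
    rw [hQd i h1]
    exact (hM _ (hdM i h1 h2)).2.2.2
  have hsl := hs.lt
  refine ⟨t, ⟨by omega, ?_, ?_, ?_, ?_⟩, ⟨rfl, by omega, hQ, hA, hQmem, hQlast, ?_⟩, hAlast, hanti,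
    hmap⟩
  · intro i h1 h2
    rcases le_or_gt i s.u with h | h
    · rw [hQ i h]
      have := hs.Q_lt i h1 h
      omega
    rcases h2.eq_or_lt with rfl | h2
    · rw [hQlast]
      omega
    · have := hQmem i h h2
      omega
  · intro i h2
    rcases le_or_gt i s.u with h | h
    · rw [hA i h]
      exact hs.mem i h
    rcases h2.eq_or_lt with rfl | h2
    · rwa [hAlast]
    · rw [hAd i h]
      exact (hM _ (hdM i h h2)).1
  · intro i h2
    rcases le_or_gt i s.u with h | h
    · rw [hA i h]
      exact hs.pos i h
    rcases h2.eq_or_lt with rfl | h2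
    · rwa [hAlast]
    · rw [hAd i h]
      exact hy.trans_le (hM _ (hdM i h h2)).2.1
  · intro j h1 h2
    change s.u ≤ j at h1
    rw [defect_eq_of_Q hs.Q_lt (by omega) hQ hA (fun i h1 h2 => (hQmem i h1 h2).2) hQlast h1,
      hAlast, sub_nonneg]
    rcases h1.eq_or_lt with rfl | h1
    · rw [if_pos rfl, hAd _ (by omega)]
      exact (hM _ (hdM _ (by omega) (by omega))).2.2.1
    rw [if_neg (by omega)]
    rcases (show j + 1 ≤ t.u from h2).eq_or_lt with h | h
    · rw [h, hAlast, hAd j h1]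
      exact (hM _ (hdM j h1 h2)).2.1
    · exact hanti j (j + 1) h1 (by omega) h
  · intro j h1 h2
    rw [← hsum j h1 h2, ← hmap, Multiset.map_map]
    rfl

theorem Valid.exists_extends {Γ : AddSubgroup ℝ} {s : Stage} (hs : Valid Γ s)
    {y : ℝ} (hyΓ : y ∈ Γ) (hy : 0 < y) {ι : Type*} [Fintype ι] {e : ι → ℝ} {c : ℕ → ι → ℕ}
    (he : ∀ m, e m ∈ Γ ∧ y ≤ e m ∧ e m ≤ s.A s.u - y)
    (hc : ∀ j, s.l ≤ j → j < s.u → s.defect j = ∑ m, c j m * e m)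
    (hne : ∃ j, s.l ≤ j ∧ j < s.u ∧ ∃ m, c j m ≠ 0) :
    ∃ t, Valid Γ t ∧ Extends s t ∧ t.A t.u = y ∧
      (∀ i j, s.u < i → i ≤ j → j < t.u → t.A j ≤ t.A i) ∧
      (∀ i, s.u < i → i < t.u → ∃ m, t.A i = e m) ∧
      ∀ j m, s.l ≤ j → j < s.u → c j m ≠ 0 → ∃ i, s.u < i ∧ i < t.u ∧ t.A i = e m := by
  classical
  let M : Multiset (ℝ × ℕ) :=
    ∑ j ∈ Finset.Ico s.l s.u, ∑ m, Multiset.replicate (c j m) (e m, j)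
  have hM : ∀ p, p ∈ M ↔ ∃ j, (s.l ≤ j ∧ j < s.u) ∧ ∃ m, c j m ≠ 0 ∧ p = (e m, j) := by
    intro p
    simp only [M, Multiset.mem_sum, Finset.mem_Ico, Finset.mem_univ, true_and,
      Multiset.mem_replicate]
  obtain ⟨t, ht, hst, hty, hanti, hmap⟩ := hs.exists_extends_of_multiset hyΓ hy (M := M) (by
      obtain ⟨j, h1, h2, m, hm⟩ := hne
      intro h0
      have := (hM (e m, j)).mpr ⟨j, ⟨h1, h2⟩, m, hm, rfl⟩
      rw [h0] at this
      simp at this) (by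
      intro p hp
      obtain ⟨j, hj, m, -, rfl⟩ := (hM p).mp hp
      exact ⟨(he m).1, (he m).2.1, (he m).2.2, hj⟩) (by
      intro j h1 h2
      rw [hc j h1 h2]
      let φ : Multiset (ℝ × ℕ) →+ ℝ := (Multiset.sumAddMonoidHom : Multiset ℝ →+ ℝ).comp
        (Multiset.mapAddMonoidHom fun p => if p.2 = j then p.1 else 0)
      change φ M = _
      rw [map_sum, Finset.sum_eq_single_of_mem j (by simp [h1, h2])]
      · rw [map_sum]
        refine Finset.sum_congr rfl fun m _ => ?_
        simp [φ]
      · intro i _ hij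
        rw [map_sum]
        refine Finset.sum_eq_zero fun m _ => ?_
        simp [φ, hij])
  refine ⟨t, ht, hst, hty, hanti, fun i h1 h2 => ?_, fun j m h1 h2 hm => ?_⟩
  · have : (t.A i, t.Q i) ∈ M := by
      rw [← hmap]
      exact Multiset.mem_map_of_mem _ (Finset.mem_Ioo.mpr ⟨h1, h2⟩)
    obtain ⟨j, -, m, -, h⟩ := (hM _).mp this
    exact ⟨m, congrArg Prod.fst h⟩
  · have : (e m, j) ∈ M := (hM _).mpr ⟨j, ⟨h1, h2⟩, m, hm, rfl⟩
    rw [← hmap, Multiset.mem_map] at this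
    obtain ⟨i, hi, h⟩ := this
    obtain ⟨h3, h4⟩ := Finset.mem_Ioo.mp (Finset.mem_val.mp hi)
    exact ⟨i, h3, h4, congrArg Prod.fst h⟩

end Stage

/-! ### Open, adapted and sharp stages. -/

namespace Stage

/-- Some weight is still to be distributed. -/
def IsOpen (Γ : AddSubgroup ℝ) (s : Stage) : Prop :=
  Valid Γ s ∧ ∃ j, s.l ≤ j ∧ j < s.u ∧ 0 < s.defect j

/-- The last weight is the sum of the largest and the smallest members of a linearly independent
family, the defects are sums of members of the family, and so is `γ` if it is positive. -/
def IsAdapted (Γ : AddSubgroup ℝ) (γ : ℝ) (s : Stage) : Prop :=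
  Valid Γ s ∧ ∃ (n : ℕ) (f : Fin (n + 2) → ℝ), StrictAnti f ∧ LinearIndependent ℤ f ∧
    (∀ m, f m ∈ Γ) ∧ (∀ m, 0 < f m) ∧ s.A s.u = f 0 + f (Fin.last (n + 1)) ∧
    (∀ j, s.l ≤ j → j < s.u → s.defect j ∈ AddSubmonoid.closure (Set.range f)) ∧
    (∃ j, s.l ≤ j ∧ j < s.u ∧ ∃ c : Fin (n + 2) → ℕ, (∀ m, 1 ≤ c m) ∧
      s.defect j = ∑ m, c m * f m) ∧
    (0 < γ → γ ∈ AddSubmonoid.closure (Set.range f))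

/-- The functional is injective on the recursive sequences, and it takes the value `γ` on a
non-negative sequence. -/
structure IsSharp (γ : ℝ) (s t : Stage) : Prop where
  inj : ∀ G : ℕ → ℤ, s.A s.u * G s.u + ∑ i ∈ Finset.Ioo s.u t.u, t.A i * G (t.Q i) = 0 →
    (∀ k, s.u ≤ k → k < t.u → G (k + 1) = G k + G (t.Q (k + 1))) →
    G t.u = 0 ∧ ∀ j, s.u ≤ j → j < t.u → t.defect j ≠ 0 → G j = 0
  surj : 0 < γ → ∃ g : ℕ → ℤ, (∀ k, 0 ≤ g k) ∧
    t.A t.u * g t.u + ∑ j ∈ Finset.Ico s.u t.u, t.defect j * g j = γ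

theorem exists_coeff_ge_one {n : ℕ} (f : Fin (n + 2) → ℝ) :
    ∃ c : Fin (n + 2) → ℕ, (∀ m, 1 ≤ c m) ∧
      2 * ∑ m, f m - (f 0 + f (Fin.last (n + 1))) = ∑ m, c m * f m := by
  -- The indices `0` and `Fin.last (n + 1)` differ, so no coefficient falls below `1`.
  refine ⟨fun m => 2 - (if m = 0 then 1 else 0) - if m = Fin.last (n + 1) then 1 else 0, ?_, ?_⟩
  · intro m
    simp only
    split_ifs with h1 h2
    · rw [h1] at h2
      exact absurd h2 (Fin.last_pos.ne)
    all_goals omega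
  · have h : ∀ m : Fin (n + 2),
        ((2 - (if m = 0 then 1 else 0) - if m = Fin.last (n + 1) then 1 else 0 : ℕ) : ℝ) * f m =
        2 * f m - (if m = 0 then f m else 0) - if m = Fin.last (n + 1) then f m else 0 := by
      intro m
      split_ifs with h1 h2
      · rw [h1] at h2
        exact absurd h2 (Fin.last_pos.ne)
      all_goals
        push_cast
        ring
    simp only [h, Finset.sum_sub_distrib, ← Finset.mul_sum, Finset.sum_ite_eq', Finset.mem_univ,
      if_true]
    ring

theorem IsOpen.exists_extends {Γ : AddSubgroup ℝ} (hone : (1 : ℝ) ∈ Γ)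
    (hirr : ¬ (Γ : Set ℝ) ⊆ Set.range ((↑) : ℚ → ℝ)) {s : Stage} (hs : IsOpen Γ s) {γ : ℝ}
    (hγ : γ ∈ Γ) : ∃ t, IsAdapted Γ γ t ∧ Extends s t := by
  classical
  obtain ⟨hs, j₀, hj₀l, hj₀u, hj₀⟩ := hs
  have hdefΓ : ∀ j < s.u, s.defect j ∈ Γ := fun j hj => by
    refine Γ.sub_mem (Γ.sub_mem (hs.mem _ hj.le) (hs.mem _ hj)) (Γ.sum_mem fun i hi => ?_)
    rw [Finset.mem_Ioc] at hi
    split_ifs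
    exacts [hs.mem i hi.2, Γ.zero_mem]
  have hsl := hs.lt
  obtain ⟨n₁, e, heanti, -, heΓ, hepos, heP⟩ := exists_strictAnti_basis hone hirr
    (insert (s.A s.u) (((Finset.Ico s.l s.u).filter fun j => 0 < s.defect j).image s.defect)) (by
      intro p hp
      simp only [Finset.mem_insert, Finset.mem_image, Finset.mem_filter, Finset.mem_Ico] at hp
      rcases hp with rfl | ⟨j, ⟨hj, hj'⟩, rfl⟩
      exacts [⟨hs.mem _ le_rfl, hs.pos _ le_rfl⟩, ⟨hdefΓ j hj.2, hj'⟩])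
  have hesum : 2 * ∑ i, e i ∈ AddSubmonoid.closure (Set.range e) :=
    mem_cone_iff.mpr ⟨fun _ => 2, by rw [Finset.mul_sum]; rfl⟩
  have hele : ∀ i, e i < s.A s.u := fun i => by
    have h1 := nonneg_of_mem_cone hepos (heP _ (Finset.mem_insert_self _ _))
    have h2 : e i ≤ ∑ i, e i := Finset.single_le_sum (fun j _ => (hepos j).le) (Finset.mem_univ i)
    have := hepos i
    linarith
  have hcoef : ∀ j, ∃ c : Fin (n₁ + 2) → ℕ, s.l ≤ j → j < s.u → s.defect j = ∑ m, c m * e m := by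
    intro j
    by_cases hj : s.l ≤ j ∧ j < s.u
    · rcases (hs.defect_nonneg j hj.1 hj.2).eq_or_lt with h | h
      · exact ⟨0, fun _ _ => by rw [← h]; simp⟩
      · have h1 := heP (s.defect j) (Finset.mem_insert_of_mem (Finset.mem_image.mpr
          ⟨j, Finset.mem_filter.mpr ⟨Finset.mem_Ico.mpr hj, h⟩, rfl⟩))
        have h2 := add_mem h1 hesum
        rw [sub_add_cancel] at h2
        obtain ⟨c, hc⟩ := mem_cone_iff.mp h2
        exact ⟨c, fun _ _ => hc⟩
    · exact ⟨0, fun h1 h2 => absurd ⟨h1, h2⟩ hj⟩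
  choose c hc using hcoef
  -- The new weights will be members of `e`, so up to the term `y` at the two ends the new defects
  -- come from this list: `A u - e i`, the differences of distinct members of `e`, and `e i`.
  -- Coordinates `≥ 2` leave room to subtract `y = f 0 + f last`.
  obtain ⟨n, f, hfanti, hfind, hfΓ, hfpos, hfP⟩ := exists_strictAnti_basis hone hirr
    (Finset.univ.image e ∪ (Finset.univ.image fun i => s.A s.u - e i) ∪
      (((Finset.univ : Finset (Fin (n₁ + 2) × Fin (n₁ + 2))).filter fun p => p.1 < p.2).image
        fun p => e p.1 - e p.2) ∪ if 0 < γ then {γ} else ∅) (by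
      intro p hp
      simp only [Finset.mem_union, Finset.mem_image, Finset.mem_filter, Finset.mem_univ,
        true_and] at hp
      rcases hp with ((⟨i, rfl⟩ | ⟨i, rfl⟩) | ⟨q, hq, rfl⟩) | hp
      · exact ⟨heΓ i, hepos i⟩
      · exact ⟨Γ.sub_mem (hs.mem _ le_rfl) (heΓ i), sub_pos.mpr (hele i)⟩
      · exact ⟨Γ.sub_mem (heΓ _) (heΓ _), sub_pos.mpr (heanti hq)⟩
      · split_ifs at hp with h
        · rw [Finset.mem_singleton.mp hp]
          exact ⟨hγ, h⟩
        · simp at hp)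
  obtain ⟨d, hd1, hd⟩ := exists_coeff_ge_one f
  have hdmem : 2 * ∑ m, f m - (f 0 + f (Fin.last (n + 1))) ∈
      AddSubmonoid.closure (Set.range f) := mem_cone_iff.mpr ⟨d, hd⟩
  have hsub : ∀ p, p - 2 * ∑ m, f m ∈ AddSubmonoid.closure (Set.range f) →
      p - (f 0 + f (Fin.last (n + 1))) ∈ AddSubmonoid.closure (Set.range f) := fun p hp => by
    have := add_mem hp hdmem
    convert this using 1
    ring
  have hmem : ∀ p, p - 2 * ∑ m, f m ∈ AddSubmonoid.closure (Set.range f) →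
      p ∈ AddSubmonoid.closure (Set.range f) := fun p hp => by
    have := add_mem (hsub p hp) (add_mem (self_mem_cone f 0) (self_mem_cone f (Fin.last (n + 1))))
    rwa [sub_add_cancel] at this
  have hPe : ∀ i, e i - 2 * ∑ m, f m ∈ AddSubmonoid.closure (Set.range f) := fun i =>
    hfP _ (by simp)
  have hPa : ∀ i, s.A s.u - e i - 2 * ∑ m, f m ∈ AddSubmonoid.closure (Set.range f) := fun i =>
    hfP _ (by simp)
  have hPd : ∀ i k, i < k → e i - e k - 2 * ∑ m, f m ∈ AddSubmonoid.closure (Set.range f) :=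
    fun i k hik => hfP _ (by
      refine Finset.mem_union_left _ (Finset.mem_union_right _ (Finset.mem_image.mpr ?_))
      exact ⟨(i, k), by simp [hik], rfl⟩)
  set y := f 0 + f (Fin.last (n + 1)) with hy
  obtain ⟨t, ht, hst, hty, hanti, hval, -⟩ := hs.exists_extends (y := y)
    (Γ.add_mem (hfΓ _) (hfΓ _)) (add_pos (hfpos _) (hfpos _)) (e := e) (c := c)
    (fun m => ⟨heΓ m, sub_nonneg.mp (nonneg_of_mem_cone hfpos (hsub _ (hPe m))), by
      have := nonneg_of_mem_cone hfpos (hsub _ (hPa m))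
      linarith⟩) hc ⟨j₀, hj₀l, hj₀u, by
        by_contra! h
        rw [hc j₀ hj₀l hj₀u] at hj₀
        simp [h] at hj₀⟩
  have hu := hst.u_le
  have hl := hst.l_eq
  refine ⟨t, ⟨ht, n, f, hfanti, hfind, hfΓ, hfpos, hty, ?_, ?_, ?_⟩, hst⟩
  · intro j h1 h2
    rw [hl] at h1
    rw [hst.defect_eq hs h1, hty]
    rcases h1.eq_or_lt with rfl | h1
    · obtain ⟨m, hm⟩ := hval (s.u + 1) (by omega) (by omega)
      rw [if_pos rfl, hm]
      have := hsub _ (hPa m)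
      rwa [sub_right_comm] at this
    · obtain ⟨m, hm⟩ := hval j h1 h2
      rw [if_neg (by omega), hm]
      rcases (show j + 1 ≤ t.u from h2).eq_or_lt with h | h
      · rw [h, hty]
        exact hsub _ (hPe m)
      · obtain ⟨k, hk⟩ := hval (j + 1) (by omega) h
        have hle := hanti j (j + 1) h1 (by omega) h
        rw [hm, hk, heanti.le_iff_ge] at hle
        rw [hk]
        rcases hle.eq_or_lt with rfl | hlt
        · rw [sub_self]
          exact zero_mem _
        · exact hmem _ (hPd m k hlt)
  -- The last new defect is `e m - y`, and `2 ∑ f - y` alone already has all coordinates `≥ 1`.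
  · obtain ⟨m, hm⟩ := hval (t.u - 1) (by omega) (by omega)
    obtain ⟨b, hb⟩ := mem_cone_iff.mp (hPe m)
    refine ⟨t.u - 1, by omega, by omega, b + d, fun i => ?_, ?_⟩
    · have := hd1 i
      simp only [Pi.add_apply]
      omega
    · rw [hst.defect_eq hs (by omega), if_neg (by omega), hm, Nat.sub_add_cancel (by omega), hty]
      simp only [Pi.add_apply, Nat.cast_add, add_mul, Finset.sum_add_distrib]
      rw [← hb, ← hd]
      ring
  · intro h
    refine hmem _ (hfP _ (Finset.mem_union_right _ ?_))
    rw [if_pos h]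
    exact Finset.mem_singleton_self γ

theorem Extends.sum_defect {Γ : AddSubgroup ℝ} {s t : Stage} (hst : Extends s t)
    (hs : Valid Γ s) {i : ℕ} (hi : s.u ≤ i) (hi' : i ≤ t.u) :
    ∑ j ∈ Finset.Ico i t.u, t.defect j =
      (if i = s.u then s.A s.u - t.A t.u else t.A i) - t.A t.u := by
  have hu := hst.u_le
  have h := Finset.sum_Ico_sub (fun j => -(if j = s.u then s.A s.u - t.A t.u else t.A j)) hi'
  rw [if_neg (by omega)] at h
  rw [sub_neg_eq_add, neg_add_eq_sub] at h
  rw [← h]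
  refine Finset.sum_congr rfl fun j hj => ?_
  rw [Finset.mem_Ico] at hj
  rw [hst.defect_eq hs (by omega), if_neg (show j + 1 ≠ s.u by omega)]
  ring

theorem IsAdapted.exists_extends {Γ : AddSubgroup ℝ} {s : Stage} {γ : ℝ} (hs : IsAdapted Γ γ s) :
    ∃ t, IsOpen Γ t ∧ Extends s t ∧ IsSharp γ s t := by
  classical
  obtain ⟨hs, n, f, hfanti, hfind, hfΓ, hfpos, hsA, hdef, ⟨j₀, hj₀l, hj₀u, c₀, hc₀1, hc₀⟩, hγ⟩ := hs
  have hcoef : ∀ j, ∃ c : Fin (n + 2) → ℕ, (s.l ≤ j → j < s.u → s.defect j = ∑ m, c m * f m) ∧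
      (j = j₀ → ∀ m, 1 ≤ c m) := by
    intro j
    by_cases hj₀ : j = j₀
    · exact ⟨c₀, fun _ _ => by rw [hj₀, hc₀], fun _ => hc₀1⟩
    by_cases hj : s.l ≤ j ∧ j < s.u
    · obtain ⟨c, hc⟩ := mem_cone_iff.mp (hdef j hj.1 hj.2)
      exact ⟨c, fun _ _ => hc, fun h => absurd h hj₀⟩
    · exact ⟨0, fun h1 h2 => absurd ⟨h1, h2⟩ hj, fun h => absurd h hj₀⟩
  choose c hc hc1 using hcoef
  obtain ⟨t, ht, hst, hty, hanti, hval, hocc⟩ := hs.exists_extends (y := f (Fin.last (n + 1)))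
    (hfΓ _) (hfpos _) (e := f) (c := c)
    (fun m => ⟨hfΓ m, hfanti.antitone (Fin.le_last m), by
      rw [hsA, add_sub_cancel_right]
      exact hfanti.antitone (Fin.zero_le m)⟩) hc
    ⟨j₀, hj₀l, hj₀u, 0, by have := hc1 j₀ rfl 0; omega⟩
  have hu := hst.u_le
  have hl := hst.l_eq
  have hocc' : ∀ m, ∃ i, s.u < i ∧ i < t.u ∧ t.A i = f m := fun m =>
    hocc j₀ m hj₀l hj₀u (by have := hc1 j₀ rfl m; omega)
  refine ⟨t, ⟨ht, ?_⟩, hst, ?_, ?_⟩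
  · by_contra! hcon
    -- The new defects add up to `f 0 - f last > 0`, so one of them is positive.
    have h1 := hst.sum_defect hs le_rfl (by omega)
    have h2 : ∑ j ∈ Finset.Ico s.u t.u, t.defect j ≤ 0 := Finset.sum_nonpos fun j hj => by
      rw [Finset.mem_Ico] at hj
      exact hcon j (by omega) hj.2
    rw [h1, if_pos rfl, hty, hsA] at h2
    have := hfanti (Fin.last_pos : (0 : Fin (n + 2)) < Fin.last (n + 1))
    linarith
  · intro G hG hrec
    choose! σ hσ using hval
    -- `z m` is the coefficient of `f m` in the value on `G`; the weight `A u = f 0 + f last`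
    -- contributes `G u` to the first and to the last coefficient.
    let z : Fin (n + 2) → ℤ := fun m => (if m = 0 then G s.u else 0) +
      (if m = Fin.last (n + 1) then G s.u else 0) +
      ∑ i ∈ Finset.Ioo s.u t.u, if σ i = m then G (t.Q i) else 0
    have hsum : ∀ S : Finset (Fin (n + 2)), ∑ m ∈ S, z m = (if 0 ∈ S then G s.u else 0) +
        (if Fin.last (n + 1) ∈ S then G s.u else 0) +
        ∑ i ∈ Finset.Ioo s.u t.u, if σ i ∈ S then G (t.Q i) else 0 := fun S => by
      simp only [z, Finset.sum_add_distrib]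
      rw [Finset.sum_ite_eq', Finset.sum_ite_eq', Finset.sum_comm]
      simp only [Finset.sum_ite_eq]
    have hz : ∀ m, z m = 0 := by
      refine Fintype.linearIndependent_iff.mp hfind z ?_
      rw [← hG, hsA]
      simp only [z, zsmul_eq_mul, Int.cast_add, Int.cast_sum, add_mul, Finset.sum_add_distrib,
        Finset.sum_mul, Int.cast_ite, Int.cast_zero, ite_mul, zero_mul, Finset.sum_ite_eq',
        Finset.mem_univ, if_true]
      rw [Finset.sum_comm]
      simp only [Finset.sum_ite_eq, Finset.mem_univ, if_true]
      have : ∑ i ∈ Finset.Ioo s.u t.u, (G (t.Q i) : ℝ) * f (σ i) =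
          ∑ i ∈ Finset.Ioo s.u t.u, t.A i * G (t.Q i) := Finset.sum_congr rfl fun i hi => by
        rw [Finset.mem_Ioo] at hi
        rw [hσ i hi.1 hi.2, mul_comm]
      rw [this]
      ring
    have hzS : ∀ S : Finset (Fin (n + 2)), ∑ m ∈ S, z m = 0 := fun S =>
      Finset.sum_eq_zero fun m _ => hz m
    have hGsum : ∀ j, s.u ≤ j → j < t.u → G j = G s.u + ∑ i ∈ Finset.Ioc s.u j, G (t.Q i) := by
      intro j hj
      induction j, hj using Nat.le_induction with
      | base => simp
      | succ j hj ih =>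
        intro hj'
        rw [hrec j hj (by omega), ih (by omega), Finset.sum_Ioc_succ_top (by omega), add_assoc]
    constructor
    -- The sum of all `z m` is `G (t.u)`: unrolling the recursion produces all `G (Q i)` and one `G
    -- u`, and the last step, with `Q (t.u) = u`, produces the second `G u`.
    · have h1 := hzS Finset.univ
      rw [hsum] at h1
      simp only [Finset.mem_univ, if_true] at h1
      have h2 := hrec (t.u - 1) (by omega) (by omega)
      rw [Nat.sub_add_cancel (by omega), hst.Q_last, hGsum (t.u - 1) (by omega) (by omega)] at h2
      have h3 : Finset.Ioc s.u (t.u - 1) = Finset.Ioo s.u t.u := by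
        ext i
        simp only [Finset.mem_Ioc, Finset.mem_Ioo]
        omega
      rw [h3] at h2
      rw [h2, ← h1]
      ring
    · intro j h1 h2 hne
      have hpos := lt_of_le_of_ne (ht.defect_nonneg j (by omega) h2) (Ne.symm hne)
      rw [hst.defect_eq hs h1, sub_pos] at hpos
      have hge : f (Fin.last (n + 1)) ≤ t.A (j + 1) := by
        rcases (show j + 1 ≤ t.u from h2).eq_or_lt with h | h
        · rw [h, hty]
        · rw [hσ (j + 1) (by omega) h]
          exact hfanti.antitone (Fin.le_last _)
      -- At `j = u` the defect is `f 0 - A (u + 1)`, so `u` acts as an index of weight `f 0`.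
      have hlt0 : t.A (j + 1) < f 0 := by
        refine hpos.trans_le ?_
        split_ifs with h
        · rw [hsA, hty]
          simp
        · rw [hσ j (by omega) h2]
          exact hfanti.antitone (Fin.zero_le _)
      -- A non-zero defect at `j` is a strict drop of the weight. By monotonicity the new indices of
      -- weight above `A (j + 1)` are those up to `j`, so this partial sum of the `z m` is `G j`.
      have h3 := hzS (Finset.univ.filter fun m => t.A (j + 1) < f m)
      rw [hsum] at h3
      simp only [Finset.mem_filter, Finset.mem_univ, true_and, if_pos hlt0,
        if_neg (not_lt.mpr hge), add_zero] at h3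
      rw [hGsum j h1 h2, ← h3, add_right_inj, ← Finset.sum_filter]
      refine Finset.sum_congr ?_ fun _ _ => rfl
      ext i
      simp only [Finset.mem_Ioc, Finset.mem_filter, Finset.mem_Ioo]
      constructor
      · rintro ⟨h4, h5⟩
        refine ⟨⟨h4, by omega⟩, ?_⟩
        rw [← hσ i h4 (by omega)]
        rw [if_neg (by omega)] at hpos
        exact hpos.trans_le (hanti i j h4 h5 h2)
      · rintro ⟨⟨h4, h5⟩, h6⟩
        refine ⟨h4, ?_⟩
        by_contra! h7
        rw [← hσ i h4 h5] at h6
        exact absurd (hanti (j + 1) i (by omega) (by omega) h5) (not_le.mpr h6)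
  · intro h
    obtain ⟨b, hb⟩ := mem_cone_iff.mp (hγ h)
    choose i hi1 hi2 hi3 using hocc'
    -- If `A i = f m`, the defects from `i` on telescope to `f m - A (t.u)`; hence the step function
    -- jumping at `i` has the value `f m`.
    refine ⟨fun k => ∑ m, b m * if i m ≤ k then 1 else 0, fun k => ?_, ?_⟩
    · exact Finset.sum_nonneg fun m _ => mul_nonneg (Int.natCast_nonneg _) (by split_ifs <;> simp)
    · have hV : ∀ m, f m = t.A t.u + ∑ j ∈ Finset.Ico s.u t.u,
          t.defect j * (if i m ≤ j then 1 else 0) := fun m => by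
        have h1 := hst.sum_defect hs (hi1 m).le (hi2 m).le
        rw [if_neg (hi1 m).ne', hi3 m] at h1
        simp only [mul_ite, mul_one, mul_zero]
        rw [← Finset.sum_filter]
        have h2 : (Finset.Ico s.u t.u).filter (fun j => i m ≤ j) = Finset.Ico (i m) t.u := by
          ext j
          have := hi1 m
          simp only [Finset.mem_filter, Finset.mem_Ico]
          omega
        rw [h2, h1]
        ring
      rw [hb]
      simp only [Int.cast_sum, Int.cast_mul, Int.cast_natCast, Int.cast_ite, Int.cast_one,
        Int.cast_zero, Finset.mul_sum]
      rw [Finset.sum_comm, ← Finset.sum_add_distrib]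
      refine Finset.sum_congr rfl fun m _ => ?_
      rw [hV m, if_pos (hi2 m).le, mul_add, Finset.mul_sum]
      refine congrArg₂ _ (by ring) (Finset.sum_congr rfl fun j _ => by ring)

end Stage

/-- The sequence that equals `g` up to the index `m` and is recursive from `m` on. -/
def recursiveExtension (Q : ℕ → ℕ) (g : ℕ → ℤ) (m : ℕ) : ℕ → ℤ
  | 0 => g 0
  | k + 1 => if k + 1 ≤ m then g (k + 1) else
      recursiveExtension Q g m k + recursiveExtension Q g m (min (Q (k + 1)) k)
termination_by k => k
decreasing_by all_goals omega

theorem recursiveExtension_of_le {Q : ℕ → ℕ} {g : ℕ → ℤ} {m k : ℕ} (hk : k ≤ m) :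
    recursiveExtension Q g m k = g k := by
  cases k with
  | zero => rw [recursiveExtension]
  | succ k => rw [recursiveExtension, if_pos hk]

theorem isRecursiveFrom_recursiveExtension {Q : ℕ → ℕ} (hQ : ∀ k, 1 ≤ k → Q k ≤ k - 1)
    (g : ℕ → ℤ) (m : ℕ) : IsRecursiveFrom Q m (recursiveExtension Q g m) := fun k hk => by
  have h : min (Q (k + 1)) k = Q (k + 1) := min_eq_left (by simpa using hQ (k + 1) (by omega))
  rw [recursiveExtension, if_neg (by omega), h]

theorem recursiveExtension_nonneg {Q : ℕ → ℕ} {g : ℕ → ℤ} (hg : ∀ k, 0 ≤ g k) (m k : ℕ) :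
    0 ≤ recursiveExtension Q g m k := by
  induction k using Nat.strong_induction_on with
  | _ k ih =>
    cases k with
    | zero =>
      rw [recursiveExtension]
      exact hg 0
    | succ k =>
      rw [recursiveExtension]
      split_ifs
      · exact hg _
      · exact add_nonneg (ih k (by omega)) (ih _ (by omega))

/-! ### The sequence of stages and its limit. -/

namespace Stage

theorem exists_initial {Γ : AddSubgroup ℝ} (hone : (1 : ℝ) ∈ Γ)
    (hirr : ¬ (Γ : Set ℝ) ⊆ Set.range ((↑) : ℚ → ℝ)) :
    ∃ s : Stage, IsOpen Γ s ∧ s.l = 0 ∧ s.u = 1 ∧ s.Q 0 = 0 ∧ s.Q 1 = 0 ∧ s.A 0 = 1 := by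
  obtain ⟨n, e, hind, -, heΓ, -⟩ := exists_basis_of_finset hone hirr ∅ (by simp)
  obtain ⟨α, hα, hα0, hα1⟩ := (dense_closure_of_linearIndependent hind).exists_between
    (show (0 : ℝ) < 1 / 2 by norm_num)
  have hαΓ : α ∈ Γ := by
    refine (AddSubgroup.closure_le Γ).mpr ?_ hα
    rintro _ ⟨i, rfl⟩
    exact heΓ i
  -- With `α < 1 / 2` the defect `1 - 2α` at `0` is positive: `A 1` enters once as the next weight
  -- and once because `Q 1 = 0`.
  let s : Stage := ⟨0, 1, fun _ => 0, fun i => if i = 0 then 1 else α⟩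
  have hdef : s.defect 0 = 1 - α - α := by simp [defect, s]
  have hpos : 0 < s.defect 0 := by
    rw [hdef]
    linarith
  refine ⟨s, ⟨⟨Nat.zero_lt_one, fun _ _ _ => Nat.zero_lt_one, fun i _ => ?_, fun i _ => ?_,
    fun j _ hj => ?_⟩, 0, le_rfl, Nat.zero_lt_one, hpos⟩, rfl, rfl, rfl, rfl, by simp [s]⟩
  · simp only [s]
    split_ifs
    exacts [hone, hαΓ]
  · simp only [s]
    split_ifs
    exacts [one_pos, hα0]
  · have : j = 0 := Nat.lt_one_iff.mp hj
    rw [this]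
    exact hpos.le

theorem exists_seq {Γ : AddSubgroup ℝ} (hone : (1 : ℝ) ∈ Γ)
    (hirr : ¬ (Γ : Set ℝ) ⊆ Set.range ((↑) : ℚ → ℝ)) {γ : ℕ → ℝ} (hγ : ∀ n, γ n ∈ Γ) :
    ∃ T : ℕ → Stage, ((T 0).l = 0 ∧ (T 0).u = 1 ∧ (T 0).Q 0 = 0 ∧ (T 0).Q 1 = 0 ∧ (T 0).A 0 = 1) ∧
      (∀ k, Valid Γ (T k)) ∧ (∀ k, Extends (T k) (T (k + 1))) ∧
      ∀ n, IsSharp (γ n) (T (2 * n + 1)) (T (2 * n + 2)) := by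
  obtain ⟨s₀, hs₀, h0⟩ := exists_initial hone hirr
  have hstep : ∀ (n : ℕ) (s : {s // IsOpen Γ s}), ∃ (t : Stage) (w : {w // IsOpen Γ w}),
      Valid Γ t ∧ Extends s.1 t ∧ Extends t w.1 ∧ IsSharp (γ n) t w.1 := by
    rintro n ⟨s, hs⟩
    obtain ⟨t, ht, hst⟩ := hs.exists_extends hone hirr (hγ n)
    obtain ⟨w, hw, htw, hsharp⟩ := ht.exists_extends
    exact ⟨t, ⟨w, hw⟩, ht.1, hst, htw, hsharp⟩
  choose mid nxt hmid hext hext' hsharp using hstep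
  let S : ℕ → {s // IsOpen Γ s} := fun n => Nat.rec ⟨s₀, hs₀⟩ (fun n s => nxt n s) n
  have hS : ∀ n, S (n + 1) = nxt n (S n) := fun _ => rfl
  -- Even stages are open, odd ones adapted, so the step from `2n + 1` to `2n + 2` is the sharp one
  -- for `γ n`.
  let T : ℕ → Stage := fun k => if k % 2 = 0 then (S (k / 2)).1 else mid (k / 2) (S (k / 2))
  have hT0 : ∀ n, T (2 * n) = (S n).1 := fun n => by
    have h1 : 2 * n % 2 = 0 := by omega
    have h2 : 2 * n / 2 = n := by omega
    simp only [T, h1, h2, if_true]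
  have hT1 : ∀ n, T (2 * n + 1) = mid n (S n) := fun n => by
    have h1 : ¬ (2 * n + 1) % 2 = 0 := by omega
    have h2 : (2 * n + 1) / 2 = n := by omega
    simp only [T, if_neg h1, h2]
  have hT2 : ∀ n, T (2 * n + 2) = (nxt n (S n)).1 := fun n => by
    rw [← hS]
    exact hT0 (n + 1)
  refine ⟨T, ?_, fun k => ?_, fun k => ?_, fun n => ?_⟩
  · have := hT0 0
    rw [mul_zero] at this
    rw [this]
    exact h0
  · rcases Nat.even_or_odd' k with ⟨n, rfl | rfl⟩
    · rw [hT0]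
      exact (S n).2.1
    · rw [hT1]
      exact hmid n (S n)
  · rcases Nat.even_or_odd' k with ⟨n, rfl | rfl⟩
    · rw [hT0, hT1]
      exact hext n (S n)
    · rw [hT1, hT2]
      exact hext' n (S n)
  · rw [hT1, hT2]
    exact hsharp n (S n)

section Limit

variable {Γ : AddSubgroup ℝ} {T : ℕ → Stage}

theorem u_strictMono (hT : ∀ k, Extends (T k) (T (k + 1))) : StrictMono fun k => (T k).u :=
  strictMono_nat_of_lt_succ fun k => by
    have := (hT k).u_le
    omega

theorem agree (hT : ∀ k, Extends (T k) (T (k + 1))) {n m : ℕ} (hnm : n ≤ m) {k : ℕ}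
    (hk : k ≤ (T n).u) : (T m).Q k = (T n).Q k ∧ (T m).A k = (T n).A k := by
  induction m, hnm using Nat.le_induction with
  | base => exact ⟨rfl, rfl⟩
  | succ m hnm ih =>
    have : (T n).u ≤ (T m).u := (u_strictMono hT).monotone hnm
    rw [(hT m).Q_eq k (hk.trans this), (hT m).A_eq k (hk.trans this)]
    exact ih

theorem agree_diag (hT : ∀ k, Extends (T k) (T (k + 1))) {n k : ℕ} (hk : k ≤ (T n).u) :
    (T k).Q k = (T n).Q k ∧ (T k).A k = (T n).A k := by
  have hkk : k ≤ (T k).u := (u_strictMono hT).id_le k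
  rcases le_total k n with h | h
  · obtain ⟨h1, h2⟩ := agree hT h hkk
    exact ⟨h1.symm, h2.symm⟩
  · exact agree hT h hk

/-- The common extension of the maps `Q` of a sequence of stages. -/
def limQ (T : ℕ → Stage) (k : ℕ) : ℕ := (T k).Q k

/-- The common extension of the weights of a sequence of stages. -/
def limA (T : ℕ → Stage) (k : ℕ) : ℝ := (T k).A k

theorem limQ_eq (hT : ∀ k, Extends (T k) (T (k + 1))) {n k : ℕ} (hk : k ≤ (T n).u) :
    limQ T k = (T n).Q k :=
  (agree_diag hT hk).1

theorem limA_eq (hT : ∀ k, Extends (T k) (T (k + 1))) {n k : ℕ} (hk : k ≤ (T n).u) :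
    limA T k = (T n).A k :=
  (agree_diag hT hk).2

theorem limQ_mem (hT : ∀ k, Extends (T k) (T (k + 1))) (hl : (T 0).l = 0) (hu : (T 0).u = 1)
    (hQ1 : (T 0).Q 1 = 0) {n k : ℕ} (hk : (T n).u ≤ k) (hk' : k < (T (n + 1)).u) :
    (T n).l ≤ limQ T k ∧ limQ T k < (T n).u := by
  rcases hk.eq_or_lt with rfl | hk
  · cases n with
    | zero =>
      rw [hu, limQ_eq hT (n := 0) hu.ge, hQ1, hl]
      exact ⟨le_rfl, one_pos⟩
    | succ n =>
      rw [limQ_eq hT (n := n + 1) le_rfl, (hT n).Q_last, (hT n).l_eq]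
      exact ⟨le_rfl, u_strictMono hT (Nat.lt_add_one n)⟩
  · rw [limQ_eq hT (n := n + 1) hk'.le]
    exact (hT n).Q_mem k hk hk'

theorem exists_block (hT : ∀ k, Extends (T k) (T (k + 1))) (hu : (T 0).u = 1) {k : ℕ}
    (hk : 1 ≤ k) : ∃ n, (T n).u ≤ k ∧ k < (T (n + 1)).u := by
  have hex : ∃ n, k < (T (n + 1)).u :=
    ⟨k, (Nat.lt_add_one k).trans_le ((u_strictMono hT).id_le (k + 1))⟩
  classical
  refine ⟨Nat.find hex, ?_, Nat.find_spec hex⟩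
  rcases Nat.eq_zero_or_pos (Nat.find hex) with h | h
  · rw [h, hu]
    exact hk
  · have := Nat.find_min hex (Nat.sub_lt h one_pos)
    rw [show Nat.find hex - 1 + 1 = Nat.find hex by omega] at this
    exact not_lt.mp this

theorem le_limQ (hT : ∀ k, Extends (T k) (T (k + 1))) (hl : (T 0).l = 0) (hu : (T 0).u = 1)
    (hQ1 : (T 0).Q 1 = 0) {n k : ℕ} (hk : (T (n + 1)).u ≤ k) : (T n).u ≤ limQ T k := by
  have hmono := u_strictMono hT
  obtain ⟨m, hm, hm'⟩ := exists_block hT hu (k := k) (by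
    have : (T 0).u < (T (n + 1)).u := hmono (Nat.succ_pos n)
    omega)
  have hnm : n + 1 < m + 1 := hmono.lt_iff_lt.mp (hk.trans_lt hm')
  obtain ⟨m, rfl⟩ : ∃ i, m = i + 1 := ⟨m - 1, by omega⟩
  have h1 := (limQ_mem hT hl hu hQ1 hm hm').1
  rw [(hT m).l_eq] at h1
  have h2 : (T n).u ≤ (T m).u := hmono.monotone (by omega)
  exact h2.trans h1

theorem increasingModuloIntervals_limQ (hT : ∀ k, Extends (T k) (T (k + 1))) (hl : (T 0).l = 0)
    (hu : (T 0).u = 1) (hQ0 : (T 0).Q 0 = 0) (hQ1 : (T 0).Q 1 = 0) :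
    IncreasingModuloIntervals (limQ T) := by
  have hsucc : ∀ n, (T (n + 1)).l = (T n).u := fun n => (hT n).l_eq
  refine ⟨hQ0, fun n => (T n).l, strictMono_nat_of_lt_succ fun n => ?_, hl, ?_, fun n k h1 h2 => ?_⟩
  · cases n with
    | zero =>
      rw [hsucc, hl, hu]
      exact one_pos
    | succ n =>
      rw [hsucc, hsucc]
      exact u_strictMono hT (Nat.lt_add_one n)
  · exact (hsucc 0).trans hu
  · simp only [hsucc] at h1 h2 ⊢
    exact limQ_mem hT hl hu hQ1 h1 h2

theorem limQ_le_sub_two (hT : ∀ k, Extends (T k) (T (k + 1))) (hu : (T 0).u = 1) {k : ℕ}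
    (hk : 2 ≤ k) : limQ T k ≤ k - 2 := by
  obtain ⟨n, h1, h2⟩ := exists_block hT hu (k := k - 1) (by omega)
  rcases (show k ≤ (T (n + 1)).u by omega).eq_or_lt with h | h
  · rw [limQ_eq hT h.le, h, (hT n).Q_last]
    have := (hT n).u_le
    omega
  · rw [limQ_eq hT h.le]
    have := ((hT n).Q_mem k (by omega) h).2
    omega

theorem limA_mem (hT : ∀ k, Extends (T k) (T (k + 1))) (hV : ∀ k, Valid Γ (T k)) (k : ℕ) :
    limA T k ∈ Γ :=
  (hV k).mem k ((u_strictMono hT).id_le k)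

theorem limA_pos (hT : ∀ k, Extends (T k) (T (k + 1))) (hV : ∀ k, Valid Γ (T k)) (k : ℕ) :
    0 < limA T k :=
  (hV k).pos k ((u_strictMono hT).id_le k)

theorem defect_eq_sum (hT : ∀ k, Extends (T k) (T (k + 1))) {n j : ℕ} (h1 : (T n).l ≤ j)
    (h2 : j < (T n).u) :
    (T n).defect j = ∑ i ∈ Finset.Ioo (T n).u (T (n + 1)).u,
      if limQ T i = j then limA T i else 0 := by
  rw [(hT n).balance j h1 h2]
  refine Finset.sum_congr rfl fun i hi => ?_
  rw [Finset.mem_Ioo] at hi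
  rw [limQ_eq hT hi.2.le, limA_eq hT hi.2.le]

theorem isBalanced_lim (hT : ∀ k, Extends (T k) (T (k + 1))) (hl : (T 0).l = 0)
    (hu : (T 0).u = 1) (hQ1 : (T 0).Q 1 = 0) : IsBalanced (limQ T) (limA T) := by
  intro k
  obtain ⟨n, h1, h2⟩ : ∃ n, (T n).l ≤ k ∧ k < (T n).u := by
    rcases Nat.eq_zero_or_pos k with rfl | hk
    · exact ⟨0, hl.le, by omega⟩
    · obtain ⟨n, h1, h2⟩ := exists_block hT hu hk
      exact ⟨n + 1, (hT n).l_eq.le.trans h1, h2⟩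
  have hdef := defect_eq_sum hT h1 h2
  have hlt : (T n).u < (T (n + 1)).u := u_strictMono hT (Nat.lt_add_one n)
  filter_upwards [eventually_ge_atTop (T (n + 1)).u] with N hN
  have hrest : ∀ i, (T (n + 1)).u ≤ i → (if limQ T i = k then limA T i else 0) = 0 := fun i hi =>
    if_neg (by have := le_limQ hT hl hu hQ1 hi; omega)
  have hfirst : ∑ i ∈ Finset.Ioc 0 (T n).u, (if limQ T i = k then limA T i else 0) =
      ∑ i ∈ Finset.Ioc 0 (T n).u, if (T n).Q i = k then (T n).A i else 0 :=
    Finset.sum_congr rfl fun i hi => by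
      rw [Finset.mem_Ioc] at hi
      rw [limQ_eq hT hi.2, limA_eq hT hi.2]
  rw [← Finset.sum_Ioc_consecutive _ (Nat.zero_le _) hN,
    Finset.sum_eq_zero (s := Finset.Ioc (T (n + 1)).u N) fun i hi =>
      hrest i (Finset.mem_Ioc.mp hi).1.le,
    sum_Ioc_eq hlt, hrest _ le_rfl, hfirst, ← hdef, limA_eq hT h2.le,
    limA_eq hT (show k + 1 ≤ (T n).u from h2), defect]
  ring

theorem windowValue_lim (hT : ∀ k, Extends (T k) (T (k + 1))) (hl : (T 0).l = 0)
    (hu : (T 0).u = 1) (hQ1 : (T 0).Q 1 = 0) (n : ℕ) (g : ℕ → ℤ) {N : ℕ}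
    (hN : (T (n + 1)).u ≤ N) :
    windowValue (limQ T) (limA T) N (T n).u g = limA T (T n).u * g (T n).u +
      ∑ i ∈ Finset.Ioo (T n).u (T (n + 1)).u, limA T i * g (limQ T i) := by
  have hlt : (T n).u < (T (n + 1)).u := u_strictMono hT (Nat.lt_add_one n)
  rw [windowValue, add_right_inj, ← Finset.sum_filter]
  refine Finset.sum_congr ?_ fun _ _ => rfl
  ext i
  simp only [Finset.mem_filter, Finset.mem_Ioc, Finset.mem_Ioo]
  constructor
  · rintro ⟨⟨h1, h2⟩, h3⟩
    refine ⟨h1, ?_⟩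
    by_contra! h
    have := le_limQ hT hl hu hQ1 h
    omega
  · rintro ⟨h1, h2⟩
    exact ⟨⟨h1, by omega⟩, (limQ_mem hT hl hu hQ1 h1.le h2).2⟩

/-- Grouping the indices of the next block by their label `j = Q i` reassembles the defects. -/
theorem windowValue_lim_eq_defect (hT : ∀ k, Extends (T k) (T (k + 1))) (hl : (T 0).l = 0)
    (hu : (T 0).u = 1) (hQ1 : (T 0).Q 1 = 0) (n : ℕ) (g : ℕ → ℤ) {N : ℕ}
    (hN : (T (n + 1)).u ≤ N) :
    windowValue (limQ T) (limA T) N (T n).u g = limA T (T n).u * g (T n).u +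
      ∑ j ∈ Finset.Ico (T n).l (T n).u, (T n).defect j * g j := by
  rw [windowValue_lim hT hl hu hQ1 n g hN, add_right_inj]
  have h : ∑ j ∈ Finset.Ico (T n).l (T n).u, (T n).defect j * (g j : ℝ) =
      ∑ j ∈ Finset.Ico (T n).l (T n).u, ∑ i ∈ Finset.Ioo (T n).u (T (n + 1)).u,
        if limQ T i = j then limA T i * (g j : ℝ) else 0 :=
    Finset.sum_congr rfl fun j hj => by
      rw [Finset.mem_Ico] at hj
      rw [defect_eq_sum hT hj.1 hj.2, Finset.sum_mul]
      exact Finset.sum_congr rfl fun i _ => by split_ifs <;> simp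
  rw [h, Finset.sum_comm]
  refine Finset.sum_congr rfl fun i hi => ?_
  rw [Finset.mem_Ioo] at hi
  rw [Finset.sum_ite_eq, if_pos]
  exact Finset.mem_Ico.mpr (limQ_mem hT hl hu hQ1 hi.1.le hi.2)

theorem eventually_eq_zero_of_isSharp (hT : ∀ k, Extends (T k) (T (k + 1))) (hl : (T 0).l = 0)
    (hu : (T 0).u = 1) (hQ1 : (T 0).Q 1 = 0) (hV : ∀ k, Valid Γ (T k)) {γ : ℝ} {n K : ℕ}
    (hn : IsSharp γ (T n) (T (n + 1))) (hK : K ≤ (T n).u) {g : ℕ → ℤ}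
    (hg : IsRecursiveFrom (limQ T) K g)
    (hQ : ∀ k, 1 ≤ k → limQ T k ≤ k - 1) (hval : HasValue (limQ T) (limA T) g 0) :
    ∀ᶠ k in atTop, g k = 0 := by
  have hw := ((hg.mono hK).hasValue_iff hQ (isBalanced_lim hT hl hu hQ1)).mp hval
  obtain ⟨N, hN, hN'⟩ := (hw.and (eventually_ge_atTop (T (n + 1)).u)).exists
  rw [windowValue_lim hT hl hu hQ1 n g hN', limA_eq hT le_rfl] at hN
  have hlt : (T n).u < (T (n + 1)).u := u_strictMono hT (Nat.lt_add_one n)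
  obtain ⟨h0, h1⟩ := hn.inj g (by
      rw [← hN, add_right_inj]
      refine Finset.sum_congr rfl fun i hi => ?_
      rw [Finset.mem_Ioo] at hi
      rw [limQ_eq hT hi.2.le, limA_eq hT hi.2.le]) fun k hk hk' => by
    rw [hg k (hK.trans hk), limQ_eq hT (n := n + 1) hk']
  filter_upwards [eventually_ge_atTop (T (n + 1)).u] with k hk
  induction k using Nat.strong_induction_on with
  | _ k ih =>
    rcases hk.eq_or_lt with rfl | hk
    · exact h0
    obtain ⟨k, rfl⟩ : ∃ i, k = i + 1 := ⟨k - 1, by omega⟩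
    have hQk : limQ T (k + 1) ≤ k := by simpa using hQ (k + 1) (by omega)
    rw [hg k (by omega), ih k (by omega) (by omega), zero_add]
    rcases le_or_gt (T (n + 1)).u (limQ T (k + 1)) with h | h
    · exact ih _ (by omega) h
    have h2 : k + 1 < (T (n + 1 + 1)).u := by
      by_contra! hc
      have := le_limQ hT hl hu hQ1 hc
      omega
    have h3 : (T n).u ≤ limQ T (k + 1) := le_limQ hT hl hu hQ1 hk.le
    -- The index `k + 1` is labelled by `Q (k + 1)`, so its positive weight is part of the defect
    -- there; hence sharpness applies to every place of the block that the recursion still uses.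
    refine h1 _ h3 h (ne_of_gt ?_)
    rw [defect_eq_sum hT ((hT n).l_eq.le.trans h3) h]
    have hnn : ∀ i ∈ Finset.Ioo (T (n + 1)).u (T (n + 1 + 1)).u,
        0 ≤ if limQ T i = limQ T (k + 1) then limA T i else 0 := fun i _ => by
      split_ifs
      exacts [(limA_pos hT hV i).le, le_rfl]
    refine lt_of_lt_of_le ?_ (Finset.single_le_sum hnn (Finset.mem_Ioo.mpr ⟨hk, h2⟩))
    rw [if_pos rfl]
    exact limA_pos hT hV _

theorem exists_hasValue_of_isSharp (hT : ∀ k, Extends (T k) (T (k + 1))) (hl : (T 0).l = 0)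
    (hu : (T 0).u = 1) (hQ1 : (T 0).Q 1 = 0) {γ : ℝ} (hγ : 0 < γ) {n : ℕ}
    (hn : IsSharp γ (T n) (T (n + 1))) (hQ : ∀ k, 1 ≤ k → limQ T k ≤ k - 1) :
    ∃ K g, IsRecursiveFrom (limQ T) K g ∧ (∀ k, 0 ≤ g k) ∧ HasValue (limQ T) (limA T) g γ := by
  obtain ⟨g, hg0, hg⟩ := hn.surj hγ
  have hrec := isRecursiveFrom_recursiveExtension hQ g (T (n + 1)).u
  refine ⟨_, _, hrec, recursiveExtension_nonneg hg0 _,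
    (hrec.hasValue_iff hQ (isBalanced_lim hT hl hu hQ1)).mpr ?_⟩
  filter_upwards [eventually_ge_atTop (T (n + 1 + 1)).u] with N hN
  rw [windowValue_lim_eq_defect hT hl hu hQ1 (n + 1) _ hN, ← hg, limA_eq hT le_rfl,
    recursiveExtension_of_le le_rfl, (hT n).l_eq]
  refine congrArg₂ _ rfl (Finset.sum_congr rfl fun j hj => ?_)
  rw [recursiveExtension_of_le (Finset.mem_Ico.mp hj).2.le]

end Limit

end Stage

/-! ### Realization of the given group. -/

theorem mainTheorem3 (Γ : AddSubgroup ℝ) (hcount : (Γ : Set ℝ).Countable)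
    (hone : (1 : ℝ) ∈ Γ) (hirr : ¬ (Γ : Set ℝ) ⊆ Set.range ((↑) : ℚ → ℝ)) :
    ∃ Q : ℕ → ℕ,
      IncreasingModuloIntervals Q ∧ Q 0 = 0 ∧ Q 1 = 0 ∧ (∀ k, 2 ≤ k → Q k ≤ k - 2) ∧
      IsCantorSet (OdometerSpace Q) ∧
      (∀ n, odometerMap Q (expansion Q n) = expansion Q (n + 1)) ∧
      IsMinimalCantorSystem (OdometerSpace Q) (odometerMap Q) ∧
      IsUnitalOrderedGroup (KZero (odometerMap Q)) (KZero.positive (odometerMap Q))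
        (KZero.unit (odometerMap Q)) ∧
      UnitalOrderedGroupIsomorphic
        (KZero (odometerMap Q)) (KZero.positive (odometerMap Q)) (KZero.unit (odometerMap Q))
        Γ {x : Γ | 0 ≤ (x : ℝ)} ⟨1, hone⟩ := by
  have hne : Nonempty Γ := ⟨0⟩
  have : Countable Γ := hcount.to_subtype
  obtain ⟨γ, hγ⟩ := exists_surjective_nat Γ
  obtain ⟨T, ⟨hl, hu, hQ0, hQ1, hA0⟩, hV, hT, hsharp⟩ :=
    Stage.exists_seq hone hirr fun n => (γ n).2
  have hinc := Stage.increasingModuloIntervals_limQ hT hl hu hQ0 hQ1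
  have hQ := hinc.le_pred
  refine ⟨Stage.limQ T, hinc, hQ0, ?_, fun k => Stage.limQ_le_sub_two hT hu,
    main_of_weights hone hinc (A := Stage.limA T) hA0 (Stage.limA_mem hT hV)
      (Stage.limA_pos hT hV) (Stage.isBalanced_lim hT hl hu hQ1) (fun K g hg hval => ?_)
      fun x hx hx0 => ?_⟩
  · rw [Stage.limQ_eq hT hu.ge, hQ1]
  -- The stage must begin after the index `K` from which `g` is recursive; `2K + 1` is far enough
  -- since `u` is strictly increasing.
  · refine Stage.eventually_eq_zero_of_isSharp hT hl hu hQ1 hV (hsharp K) ?_ hg hQ hval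
    have : 2 * K + 1 ≤ (T (2 * K + 1)).u := (Stage.u_strictMono hT).id_le _
    omega
  · obtain ⟨n, hn⟩ := hγ ⟨x, hx⟩
    have hs := hsharp n
    rw [hn] at hs
    exact Stage.exists_hasValue_of_isSharp hT hl hu hQ1 hx0 hs hQ
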